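/- Let $<$ be a strict partial order (irreflexive and transitive) on the finite sets of propositional variables such that $E' \subset E$ implies $E' < E$ (for instance proper containment, or comparison of cardinalities), and assume that $E' < E$ can be decided in polynomial time, given $E'$ and $E$. An abduction frame $\langle F, I, C\rangle$ consists of a propositional formula $F$ and two disjoint finite sets of variables $I$ (hypotheses) and $C$ (manifestations). It supports $E \Rightarrow M$, where $E \subseteq I$ and $\emptyset \neq M \subseteq C$, if $F \cup E$ is consistent and entails every variable of $M$. Let $\mathrm{abduct}(F,I,C)$ be the set of the supported explanations, and let $$\mathrm{minabduct}(F,I,C) = \{E \Rightarrow M \in \mathrm{abduct}(F,I,C) \mid \text{there is no } E' < E \text{ with } E' \Rightarrow M \in \mathrm{abduct}(F,I,C)\}.$$ For a finite set $R$ of variables to remember, the two ways of minimally forgetting the other variables yield the sets $$\mathrm{focus}(F,I,C,R) = \{E \Rightarrow M \mid E \subseteq I \cap R,\ \emptyset \neq M \subseteq C \cap R,\ \exists E' \subseteq I \setminus R\ \exists M' \subseteq C \setminus R:\ E \cup E' \Rightarrow M \cup M' \in \mathrm{minabduct}(F,I,C)\},$$ $$\mathrm{summarize}(F,I,C,R)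 = \{E \Rightarrow M \mid E \subseteq I \cap R,\ M \subseteq C \cap R,\ \exists E' \subseteq I \setminus R:\ E \cup E' \Rightarrow M \in \mathrm{minabduct}(F,I,C)\}.$$ Theorem. The following two decision problems are in $\Pi_4^p$: given $\langle F, I, C\rangle$ and $R$, decide whether there is a propositional formula $G$ such that $\mathrm{minabduct}(G, I \cap R, C \cap R) = \mathrm{focus}(F,I,C,R)$; and, given the same input, decide whether there is a propositional formula $G$ such that $\mathrm{minabduct}(G, I \cap R, C \cap R) = \mathrm{summarize}(F,I,C,R)$. -/

import Mathlib

namespace AbdForget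

/-! ## Machine model: programs over binary trees, with a step count -/

/-- Binary trees (S-expressions over one atom): the data of the machine model.
A tree is also read as a list, `nil` being the empty list and `cons` adding a first element. -/
inductive Data : Type
  | nil : Data
  | cons (a b : Data) : Data
  deriving DecidableEq

namespace Data

/-- Number of `cons` cells. A tree with `n` cells is written with `2 * n + 1` bits, so this is the
usual length of an input up to a constant factor. -/
def size : Data → ℕ
  | nil => 0
  | cons a b => a.size + b.size + 1

/-- First component (`nil` has the components `nil` and `nil`). -/
def hd : Data → Data
  | nil => nil
  | cons a _ => a

/-- Second component. -/
def tl : Data → Data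
  | nil => nil
  | cons _ b => b

end Data

/-- Programs. A program transforms one tree (its store) into a tree; `nil` is the truth value
false, every other tree is true. -/
inductive Prog : Type
  /-- the constant `nil` -/
  | nil : Prog
  /-- the input itself -/
  | id : Prog
  /-- the first component of the input -/
  | hd : Prog
  /-- the second component of the input -/
  | tl : Prog
  /-- are the two components of the input equal? -/
  | eq : Prog
  /-- run both programs on the input, and pair the results -/
  | pair (p q : Prog) : Prog
  /-- run `p`, then `q` on the result -/
  | comp (p q : Prog) : Prog
  /-- if `c` then `p` else `q` -/
  | ite (c p q : Prog) : Prog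
  /-- while `c` do `p` -/
  | loop (c p : Prog) : Prog

/-- `Runs p x y t`: on the input `x` the program `p` halts with the output `y` after `t` steps.
An elementary operation is charged the size of the whole tree it works on plus one (so it takes a
multitape Turing machine a time linear in its charge), and composite programs are charged all
the programs that they run, plus one for each composition, branching or iteration. Hence a run with
`t` steps is simulated by a Turing machine in time polynomial in `t` and vice versa. -/
inductive Runs : Prog → Data → Data → ℕ → Prop
  | nil (x : Data) : Runs .nil x .nil (x.size + 1)
  | id (x : Data) : Runs .id x x (x.size + 1)
  | hd (x : Data) : Runs .hd x x.hd (x.size + 1)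
  | tl (x : Data) : Runs .tl x x.tl (x.size + 1)
  | eq (x : Data) : Runs .eq x (if x.hd = x.tl then .cons .nil .nil else .nil) (x.size + 1)
  | pair {p q : Prog} {x y z : Data} {s t : ℕ} :
      Runs p x y s → Runs q x z t → Runs (.pair p q) x (.cons y z) (s + t + 1)
  | comp {p q : Prog} {x y z : Data} {s t : ℕ} :
      Runs p x y s → Runs q y z t → Runs (.comp p q) x z (s + t + 1)
  | ite_true {c p q : Prog} {x b y : Data} {s t : ℕ} :
      Runs c x b s → b ≠ .nil → Runs p x y t → Runs (.ite c p q) x y (s + t + 1)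
  | ite_false {c p q : Prog} {x y : Data} {s t : ℕ} :
      Runs c x .nil s → Runs q x y t → Runs (.ite c p q) x y (s + t + 1)
  | loop_stop {c p : Prog} {x : Data} {s : ℕ} :
      Runs c x .nil s → Runs (.loop c p) x x (s + 1)
  | loop_step {c p : Prog} {x b y z : Data} {s t u : ℕ} :
      Runs c x b s → b ≠ .nil → Runs p x y t → Runs (.loop c p) y z u →
      Runs (.loop c p) x z (s + t + u + 1)

/-! ## The polynomial hierarchy -/

/-- A decision problem, as the set of its yes-instances. -/
abbrev Problem := Set Data

/-- The class P: some program decides the problem, on every input, in a number of steps that is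
bounded by a polynomial in the size of the input. -/
def ClassP : Set Problem :=
  {L | ∃ (p : Prog) (q : Polynomial ℕ), ∀ x : Data, ∃ (y : Data) (t : ℕ),
    Runs p x y t ∧ t ≤ q.eval x.size ∧ (y ≠ .nil ↔ x ∈ L)}

/-- The classes `Σₖᵖ`: `Σ₀ᵖ = P`, and the problems of `Σₖ₊₁ᵖ` are obtained by a polynomially
bounded existential quantifier from those whose complement is in `Σₖᵖ`. -/
def SigmaP : ℕ → Set Problem
  | 0 => ClassP
  | k + 1 => {L | ∃ L' : Problem, L'ᶜ ∈ SigmaP k ∧ ∃ q : Polynomial ℕ, ∀ x : Data,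
      (x ∈ L ↔ ∃ y : Data, y.size ≤ q.eval x.size ∧ Data.cons x y ∈ L')}

/-- The classes `Πₖᵖ`: complements of the problems in `Σₖᵖ`. -/
def PiP (k : ℕ) : Set Problem :=
  {L | Lᶜ ∈ SigmaP k}

/-! ## Propositional formulae -/

/-- Propositional variables are named by bit strings. -/
abbrev Var := List Bool

/-- Propositional formulae. -/
inductive PropFormula : Type
  | fls : PropFormula
  | var (v : Var) : PropFormula
  | neg (A : PropFormula) : PropFormula
  | and (A B : PropFormula) : PropFormula
  | or (A B : PropFormula) : PropFormula
  | imp (A B : PropFormula) : PropFormula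

/-- Truth value of a formula under a truth assignment. -/
def PropFormula.eval (v : Var → Bool) : PropFormula → Bool
  | fls => false
  | var x => v x
  | neg A => !A.eval v
  | and A B => A.eval v && B.eval v
  | or A B => A.eval v || B.eval v
  | imp A B => !A.eval v || B.eval v

/-- The truth assignment `v` is a model of `F ∪ E`. -/
def IsModel (v : Var → Bool) (F : PropFormula) (E : Finset Var) : Prop :=
  F.eval v = true ∧ ∀ e ∈ E, v e = true

/-- `F ∪ E` is consistent. -/
def Consistent (F : PropFormula) (E : Finset Var) : Prop :=
  ∃ v, IsModel v F E

/-- `F ∪ E` entails all variables in `M`. -/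
def Entails (F : PropFormula) (E M : Finset Var) : Prop :=
  ∀ v, IsModel v F E → ∀ m ∈ M, v m = true

/-! ## Abduction, minimal explanations, forgetting -/

/-- An abduction frame `⟨F, I, C⟩`: a formula and disjoint finite sets of hypotheses and
manifestations. -/
structure AbductionFrame where
  formula : PropFormula
  hyps : Finset Var
  manis : Finset Var
  disj : Disjoint hyps manis

/-- A pair `(E, M)` stands for `E ⇒ M`. -/
abbrev Explanation := Finset Var × Finset Var

namespace AbductionFrame

/-- The explanations `E ⇒ M` supported by the frame: `E ⊆ I`, `∅ ≠ M ⊆ C`, and `F ∪ E` is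
consistent and entails `M`. -/
def abduct (A : AbductionFrame) : Set Explanation :=
  {x | x.1 ⊆ A.hyps ∧ x.2 ⊆ A.manis ∧ x.2.Nonempty ∧
    Consistent A.formula x.1 ∧ Entails A.formula x.1 x.2}

/-- The minimally supported explanations: no `E' < E` is such that `E' ⇒ M` is supported. -/
def minabduct (lt : Finset Var → Finset Var → Prop) (A : AbductionFrame) : Set Explanation :=
  {x | x ∈ A.abduct ∧ ¬ ∃ E' : Finset Var, (E', x.2) ∈ A.abduct ∧ lt E' x.1}

/-- Focusing on the variables `R`, for minimal explanations. -/
def focus (lt : Finset Var → Finset Var → Prop) (A : AbductionFrame) (R : Finset Var) :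
    Set Explanation :=
  {x | x.1 ⊆ A.hyps ∩ R ∧ x.2 ⊆ A.manis ∩ R ∧ x.2.Nonempty ∧
    ∃ E' ⊆ A.hyps \ R, ∃ M' ⊆ A.manis \ R, (x.1 ∪ E', x.2 ∪ M') ∈ A.minabduct lt}

/-- Summarizing on the variables `R`, for minimal explanations. -/
def summarize (lt : Finset Var → Finset Var → Prop) (A : AbductionFrame) (R : Finset Var) :
    Set Explanation :=
  {x | x.1 ⊆ A.hyps ∩ R ∧ x.2 ⊆ A.manis ∩ R ∧
    ∃ E' ⊆ A.hyps \ R, (x.1 ∪ E', x.2) ∈ A.minabduct lt}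

/-- The frame `⟨G, I ∩ R, C ∩ R⟩`, in which a formula `G` is to express the result of
forgetting all variables but `R`. -/
def remember (A : AbductionFrame) (R : Finset Var) (G : PropFormula) : AbductionFrame where
  formula := G
  hyps := A.hyps ∩ R
  manis := A.manis ∩ R
  disj := A.disj.mono Finset.inter_subset_left Finset.inter_subset_left

end AbductionFrame

/-! ## Encodings of the inputs -/

/-- A list as a tree. -/
def encodeList {α : Type} (f : α → Data) : List α → Data
  | [] => .nil
  | a :: l => .cons (f a) (encodeList f l)

/-- A bit as a tree. -/
def encodeBit : Bool → Data
  | false => .nil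
  | true => .cons .nil .nil

/-- A variable, that is, its name, as a tree. -/
def encodeVar (v : Var) : Data :=
  encodeList encodeBit v

/-- The tag `k` as a list of `k` trees `nil`. -/
def tag : ℕ → Data
  | 0 => .nil
  | k + 1 => .cons .nil (tag k)

/-- The syntax tree of a formula, every node being tagged with its connective. -/
def encodeFormula : PropFormula → Data
  | .fls => .cons (tag 0) .nil
  | .var v => .cons (tag 1) (encodeVar v)
  | .neg A => .cons (tag 2) (encodeFormula A)
  | .and A B => .cons (tag 3) (.cons (encodeFormula A) (encodeFormula B))
  | .or A B => .cons (tag 4) (.cons (encodeFormula A) (encodeFormula B))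
  | .imp A B => .cons (tag 5) (.cons (encodeFormula A) (encodeFormula B))

/-- The tree `d` represents the finite set `s` of variables: it lists its elements, in any order and
with or without repetitions. -/
def EncodesSet (d : Data) (s : Finset Var) : Prop :=
  ∃ l : List Var, d = encodeList encodeVar l ∧ l.toFinset = s

/-- The tree `d` represents the frame `A` together with the set `R` of variables to remember. -/
def EncodesInput (d : Data) (A : AbductionFrame) (R : Finset Var) : Prop :=
  ∃ i c r : Data, EncodesSet i A.hyps ∧ EncodesSet c A.manis ∧ EncodesSet r R ∧
    d = .cons (encodeFormula A.formula) (.cons i (.cons c r))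

/-! ## The decision problems -/

/-- Comparing explanations: given `E'` and `E`, is `E' < E`? -/
def compareProblem (lt : Finset Var → Finset Var → Prop) : Problem :=
  {d | ∃ (a b : Data) (E' E : Finset Var),
    d = .cons a b ∧ EncodesSet a E' ∧ EncodesSet b E ∧ lt E' E}

/-- Given `⟨F, I, C⟩` and `R`, is there a formula whose minimal explanations are exactly the result of
focusing on `R`? -/
def focusProblem (lt : Finset Var → Finset Var → Prop) : Problem :=
  {d | ∃ (A : AbductionFrame) (R : Finset Var), EncodesInput d A R ∧
    ∃ G : PropFormula, (A.remember R G).minabduct lt = A.focus lt R}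

/-- Given `⟨F, I, C⟩` and `R`, is there a formula whose minimal explanations are exactly the result of
summarizing on `R`? -/
def summarizeProblem (lt : Finset Var → Finset Var → Prop) : Problem :=
  {d | ∃ (A : AbductionFrame) (R : Finset Var), EncodesInput d A R ∧
    ∃ G : PropFormula, (A.remember R G).minabduct lt = A.summarize lt R}

end AbdForget

/-!
Let `S` be a set of explanations over the hypotheses `I` and the manifestations `C`. The
explanations supported by a formula are those `E ⇒ M` for which `E` is consistent and `M` is
contained in the set of entailed manifestations; consistency is passed on to subsets and
entailment to supersets, and otherwise both can be prescribed at will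
(`exists_abduct_eq_leastAbduct`). So among the formulae that support all of `S` there is one that
supports the least, and its set of explanations is `leastAbduct S`. If any formula has `S` as
its set of minimal explanations, then this one has. Since `<` is well-founded on the subsets of
`I`, this amounts to two conditions (`exists_minabduct_eq_iff`): no explanation of `S` is beaten
by one of `leastAbduct S` (`Unbeaten`), and every explanation of `leastAbduct S` is in `S` or beaten
by one that is (`Dominating`).

It remains to count quantifiers. Consistency is in `Σ₁ᵖ` and entailment in `Π₁ᵖ`, so
supported explanations are in `Σ₂ᵖ ∩ Π₂ᵖ`, and minimal ones in `Π₂ᵖ` (`pi_minabduct`). Focusing and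
summarizing guess the forgotten part, hence are in `Σ₃ᵖ` (`sig_focus`, `sig_summarize`). So is
`leastAbduct S`, where the existence of an explanation for each of polynomially many
manifestations is required (`sig_leastAbduct`, `Sig.forall_mem`). The two conditions are universal
statements about `S` and `leastAbduct S`, which makes them `Π₄ᵖ` (`pi_unbeaten_and_dominating`).

The count rests on a small theory of polynomial time for programs over trees. The functions
computed in polynomial time are closed under recursion over trees with values of polynomially
bounded size (`PolyTime.treeRec`, proved with a stack machine). All elementary procedures, such as
arithmetic in unary, tests on all elements of a list and the evaluation of formulae, are instances.
Every tree is decoded to some variable, set, formula and frame, so that well-formedness of the input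
matters only once, in `IsInput`.
-/

namespace AbdForget

/-! ### Polynomial-time functions -/

theorem eval_mono (q : Polynomial ℕ) : Monotone fun n => q.eval n := by
  intro m n h
  simp only [Polynomial.eval_eq_sum, Polynomial.sum]
  gcongr

theorem Runs.size_lt {p : Prog} {x y : Data} {t : ℕ} (h : Runs p x y t) : x.size < t := by
  induction h <;> omega

theorem Runs.size_le {p : Prog} {x y : Data} {t : ℕ} (h : Runs p x y t) : y.size ≤ t := by
  induction h with
  | nil | id => simp [Data.size]
  | hd x | tl x => cases x <;> (simp [Data.size, Data.hd, Data.tl]; try omega)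
  | eq x => split_ifs <;> simp [Data.size]
  | loop_stop h _ => have := h.size_lt; omega
  | pair => simp only [Data.size]; omega
  | _ => omega

/-- `f` is computed by a program in polynomial time. -/
@[fun_prop]
def PolyTime (f : Data → Data) : Prop :=
  ∃ (p : Prog) (q : Polynomial ℕ), ∀ x, ∃ t, Runs p x (f x) t ∧ t ≤ q.eval x.size

namespace PolyTime

variable {f g : Data → Data}

theorem exists_size_le (hf : PolyTime f) : ∃ q : Polynomial ℕ, ∀ x, (f x).size ≤ q.eval x.size := by
  obtain ⟨p, q, h⟩ := hf
  refine ⟨q, fun x => ?_⟩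
  obtain ⟨t, ht, hq⟩ := h x
  exact ht.size_le.trans hq

theorem elementary {p : Prog} (h : ∀ x, Runs p x (f x) (x.size + 1)) : PolyTime f :=
  ⟨p, .X + 1, fun x => ⟨_, h x, by simp⟩⟩

@[fun_prop]
theorem id' : PolyTime fun x => x := elementary Runs.id

@[fun_prop]
theorem hd : PolyTime Data.hd := elementary Runs.hd

@[fun_prop]
theorem tl : PolyTime Data.tl := elementary Runs.tl

@[fun_prop]
theorem comp (hf : PolyTime f) (hg : PolyTime g) : PolyTime fun x => f (g x) := by
  obtain ⟨p, q, h⟩ := hf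
  obtain ⟨p', q', h'⟩ := hg
  refine ⟨.comp p' p, q' + q.comp q' + 1, fun x => ?_⟩
  obtain ⟨t', r', b'⟩ := h' x
  obtain ⟨t, r, b⟩ := h (g x)
  refine ⟨_, .comp r' r, ?_⟩
  have := eval_mono q (r'.size_le.trans b')
  simp only [Polynomial.eval_add, Polynomial.eval_comp, Polynomial.eval_one] at *
  omega

@[fun_prop]
theorem cons (hf : PolyTime f) (hg : PolyTime g) : PolyTime fun x => Data.cons (f x) (g x) := by
  obtain ⟨p, q, h⟩ := hf
  obtain ⟨p', q', h'⟩ := hg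
  refine ⟨.pair p p', q + q' + 1, fun x => ?_⟩
  obtain ⟨t', r', b'⟩ := h' x
  obtain ⟨t, r, b⟩ := h x
  refine ⟨_, .pair r r', ?_⟩
  simp only [Polynomial.eval_add, Polynomial.eval_one] at *
  omega

@[fun_prop]
theorem const (d : Data) : PolyTime fun _ => d := by
  induction d with
  | nil => exact elementary Runs.nil
  | cons a b iha ihb => exact cons iha ihb

end PolyTime

namespace Data

@[simp] theorem hd_cons (a b : Data) : (cons a b).hd = a := rfl
@[simp] theorem tl_cons (a b : Data) : (cons a b).tl = b := rfl

/-- The truth value true, as a program returns it. -/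
def one : Data := cons nil nil

/-- Case distinction: `a` if `c` is true, `b` if `c` is false, that is, `nil`. -/
def sel (c a b : Data) : Data := if c = nil then b else a

@[simp] theorem sel_nil (a b : Data) : sel nil a b = b := rfl
@[simp] theorem sel_cons (c d a b : Data) : sel (cons c d) a b = a := rfl

/-- Equality test, with a truth value as result. -/
def eqTest (a b : Data) : Data := if a = b then one else nil

end Data

namespace PolyTime

variable {f g c : Data → Data}

@[fun_prop]
theorem sel (hc : PolyTime c) (hf : PolyTime f) (hg : PolyTime g) :
    PolyTime fun x => Data.sel (c x) (f x) (g x) := by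
  obtain ⟨p₀, q₀, h₀⟩ := hc
  obtain ⟨p, q, h⟩ := hf
  obtain ⟨p', q', h'⟩ := hg
  refine ⟨.ite p₀ p p', q₀ + q + q' + 1, fun x => ?_⟩
  obtain ⟨t₀, r₀, b₀⟩ := h₀ x
  obtain ⟨t', r', b'⟩ := h' x
  obtain ⟨t, r, b⟩ := h x
  simp only [Polynomial.eval_add, Polynomial.eval_one] at *
  unfold Data.sel
  split_ifs with hn
  · exact ⟨_, .ite_false (hn ▸ r₀) r', by omega⟩
  · exact ⟨_, .ite_true r₀ hn r, by omega⟩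

@[fun_prop]
theorem eqTest (hf : PolyTime f) (hg : PolyTime g) :
    PolyTime fun x => Data.eqTest (f x) (g x) :=
  comp (f := fun x => if x.hd = x.tl then .cons .nil .nil else .nil)
    (elementary Runs.eq) (cons hf hg)

end PolyTime

/-! ### Recursion over trees -/

/-- One step of the stack machine that evaluates a function given by recursion over trees. The state
`cons e (cons w v)` consists of the parameter `e`, a stack `w` of tasks and a stack `v` of values.
The task `cons nil d` is to push the value at `d`; the task `cons one d` is to replace the two
topmost values, which are those at the components of `d`, by the value at `d`. -/
def recStep (base h : Data → Data) (s : Data) : Data :=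
  .sel s.tl.hd.hd.hd
    (.cons s.hd (.cons s.tl.hd.tl
      (.cons (h (.cons s.hd (.cons s.tl.hd.hd.tl (.cons s.tl.tl.tl.hd s.tl.tl.hd))))
        s.tl.tl.tl.tl)))
    (.sel s.tl.hd.hd.tl
      (.cons s.hd (.cons (.cons (.cons .nil s.tl.hd.hd.tl.hd) (.cons (.cons .nil s.tl.hd.hd.tl.tl)
        (.cons (.cons .one s.tl.hd.hd.tl) s.tl.hd.tl))) s.tl.tl))
      (.cons s.hd (.cons s.tl.hd.tl (.cons (base s.hd) s.tl.tl))))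

/-- If the loop below ends from the state in which the value at `d` has been pushed, then it ends
from the state in which this is the next task, after at most `3 * d.size + 1` more rounds, each of
which costs at most `C`. The number `S` bounds the size of all states on the way, and `K` that of
all values. -/
theorem runs_recLoop {base h : Data → Data} {T : Data → Data → Data}
    (T_nil : ∀ e, T e .nil = base e)
    (T_cons : ∀ e a b, T e (.cons a b) = h (.cons e (.cons (.cons a b) (.cons (T e a) (T e b)))))
    {cond step : Prog} {S C K N : ℕ} {e : Data}
    (round : ∀ s z t, s.tl.hd ≠ .nil → s.size ≤ S →
      Runs (.loop cond step) (recStep base h s) z t →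
      ∃ t', Runs (.loop cond step) s z t' ∧ t' ≤ t + C)
    (hK : ∀ d, d.size ≤ N → (T e d).size ≤ K) (d w v z : Data) (t : ℕ) (hd : d.size ≤ N)
    (hS : e.size + w.size + v.size + (d.size + 1) * (2 * N + K + 10) ≤ S)
    (run : Runs (.loop cond step) (.cons e (.cons w (.cons (T e d) v))) z t) :
    ∃ t', Runs (.loop cond step) (.cons e (.cons (.cons (.cons .nil d) w) v)) z t' ∧
      t' ≤ t + (3 * d.size + 1) * C := by
  induction d generalizing w v t with
  | nil =>
    obtain ⟨t', r, b⟩ := round (.cons e (.cons (.cons (.cons .nil .nil) w) v)) z t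
      (by simp [Data.hd, Data.tl])
      (by simp only [Data.size] at *; omega)
      (by simpa [recStep, Data.hd, Data.tl, ← T_nil] using run)
    exact ⟨t', r, by simpa [Data.size] using b⟩
  | cons a b iha ihb =>
    have ha : a.size ≤ N := by simp only [Data.size] at hd; omega
    have hb : b.size ≤ N := by simp only [Data.size] at hd; omega
    have ka := hK a ha
    have kb := hK b hb
    simp only [Data.size] at hS hd
    have la : (a.size + 1) * (2 * N + K + 10) + (2 * N + K + 10) ≤
        (a.size + b.size + 1 + 1) * (2 * N + K + 10) := by nlinarith
    have lb : (b.size + 1) * (2 * N + K + 10) + (2 * N + K + 10) ≤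
        (a.size + b.size + 1 + 1) * (2 * N + K + 10) := by nlinarith
    have lc : 2 * N + K + 10 ≤ (a.size + 1) * (2 * N + K + 10) := by nlinarith
    have ld : 2 * N + K + 10 ≤ (b.size + 1) * (2 * N + K + 10) := by nlinarith
    obtain ⟨t₁, r₁, b₁⟩ := round
      (.cons e (.cons (.cons (.cons .one (.cons a b)) w) (.cons (T e b) (.cons (T e a) v)))) z t
      (by simp [Data.hd, Data.tl])
      (by simp only [Data.size, Data.one] at *; omega)
      (by simpa [recStep, Data.hd, Data.tl, Data.one, ← T_cons] using run)
    obtain ⟨t₂, r₂, b₂⟩ := ihb _ (.cons (T e a) v) t₁ hb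
      (by simp only [Data.size, Data.one] at *; omega) r₁
    obtain ⟨t₃, r₃, b₃⟩ := iha (.cons (.cons .nil b) (.cons (.cons .one (.cons a b)) w)) v t₂ ha
      (by simp only [Data.size, Data.one] at *; omega) r₂
    obtain ⟨t₄, r₄, b₄⟩ := round (.cons e (.cons (.cons (.cons .nil (.cons a b)) w) v)) z t₃
      (by simp [Data.hd, Data.tl])
      (by simp only [Data.size, Data.one] at *; omega)
      (by simpa [recStep, Data.hd, Data.tl] using r₃)
    refine ⟨t₄, r₄, ?_⟩
    simp only [Data.size]
    nlinarith

/-- A function that is defined by recursion over trees from polynomial-time functions, and whose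
values are polynomially bounded in size, is computed in polynomial time. -/
theorem PolyTime.treeRec {base h : Data → Data} (T : Data → Data → Data)
    (hbase : PolyTime base) (hh : PolyTime h) (T_nil : ∀ e, T e .nil = base e)
    (T_cons : ∀ e a b, T e (.cons a b) = h (.cons e (.cons (.cons a b) (.cons (T e a) (T e b)))))
    (K : Polynomial ℕ) (hK : ∀ e d, (T e d).size ≤ K.eval (e.size + d.size))
    {f g : Data → Data} (hf : PolyTime f) (hg : PolyTime g) :
    PolyTime fun x => T (f x) (g x) := by
  have hstep : PolyTime (recStep base h) := by unfold recStep; fun_prop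
  have hcond : PolyTime fun s => s.tl.hd := by fun_prop
  obtain ⟨step, q, hq⟩ := hstep
  obtain ⟨cond, q', hq'⟩ := hcond
  have main : PolyTime fun x => Data.cons x.hd (.cons .nil (.cons (T x.hd x.tl) .nil)) := by
    have hinit : PolyTime fun x =>
        Data.cons x.hd (.cons (.cons (.cons .nil x.tl) .nil) .nil) := by fun_prop
    obtain ⟨ini, q₀, h₀⟩ := hinit
    -- `S` bounds the size of all states of the stack machine, and `C` the cost of a round.
    let S : Polynomial ℕ := .X + (.X + 1) * (2 * .X + K + 10) + K + 10
    let C : Polynomial ℕ := q'.comp S + q.comp S + 1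
    refine ⟨.comp ini (.loop cond step), q₀ + (q'.comp S + 1 + (3 * .X + 1) * C) + 1, fun x => ?_⟩
    obtain ⟨t₀, r₀, b₀⟩ := h₀ x
    have hsz : x.hd.size + x.tl.size ≤ x.size := by
      cases x <;> simp [Data.hd, Data.tl, Data.size]
    have hSx : S.eval x.size = x.size + (x.size + 1) * (2 * x.size + K.eval x.size + 10) +
        K.eval x.size + 10 := by simp [S]
    have hT := (hK x.hd x.tl).trans (eval_mono K hsz)
    obtain ⟨u, ru, bu⟩ := hq' (.cons x.hd (.cons .nil (.cons (T x.hd x.tl) .nil)))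
    have bu' : u ≤ q'.eval (S.eval x.size) := bu.trans (eval_mono q' (by
      simp only [Data.size, hSx]
      nlinarith))
    obtain ⟨t, r, b⟩ := runs_recLoop (C := C.eval x.size) (N := x.tl.size) (K := K.eval x.size)
      (S := S.eval x.size) (cond := cond) (step := step) (e := x.hd) T_nil T_cons
      (by
        intro s z t hs hS hr
        obtain ⟨t₁, r₁, b₁⟩ := hq s
        obtain ⟨t₂, r₂, b₂⟩ := hq' s
        refine ⟨_, .loop_step r₂ hs r₁ hr, ?_⟩
        have := eval_mono q hS
        have := eval_mono q' hS
        simp only [C, Polynomial.eval_add, Polynomial.eval_comp, Polynomial.eval_one] at *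
        omega)
      (fun d hd => (hK x.hd d).trans (eval_mono K (by omega)))
      x.tl .nil .nil _ _ le_rfl
      (by
        have : (x.tl.size + 1) * (2 * x.tl.size + K.eval x.size + 10) ≤
          (x.size + 1) * (2 * x.size + K.eval x.size + 10) := by gcongr <;> omega
        simp only [Data.size, hSx]
        omega)
      (Runs.loop_stop ru)
    refine ⟨_, .comp r₀ r, ?_⟩
    have : (3 * x.tl.size + 1) * C.eval x.size ≤ (3 * x.size + 1) * C.eval x.size := by
      gcongr; omega
    simp only [Polynomial.eval_add, Polynomial.eval_comp, Polynomial.eval_one, Polynomial.eval_mul,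
      Polynomial.eval_X, Polynomial.eval_ofNat]
    omega
  exact (show PolyTime fun x : Data => x.tl.tl.hd by fun_prop).comp (main.comp (hf.cons hg))

/-! ### Predicates decidable in polynomial time -/

namespace Data

/-- The elements of the list that a tree is read as. -/
def toList : Data → List Data
  | nil => []
  | cons a b => a :: b.toList

/-- Concatenation of lists. -/
def append : Data → Data → Data
  | nil, d => d
  | cons a b, d => cons a (b.append d)

theorem toList_append (a b : Data) : (a.append b).toList = a.toList ++ b.toList := by
  induction a with
  | nil => rfl
  | cons a c _ ih => simp [append, toList, ih]

theorem size_append (a b : Data) : (a.append b).size = a.size + b.size := by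
  induction a with
  | nil => simp [append, size]
  | cons a c _ ih => simp [append, size, ih]; omega

end Data

theorem size_tag (n : ℕ) : (tag n).size = n := by
  induction n with
  | zero => rfl
  | succ n ih => simp [tag, Data.size, ih]

theorem tag_append_tag (m n : ℕ) : (tag m).append (tag n) = tag (m + n) := by
  induction m with
  | zero => simp [tag, Data.append]
  | succ m ih => rw [Nat.succ_add]; simp [tag, Data.append, ih]

theorem length_toList_tag (n : ℕ) : (tag n).toList.length = n := by
  induction n with
  | zero => rfl
  | succ n ih => simp [tag, Data.toList, ih]

theorem tag_ne_nil {n : ℕ} : tag n ≠ .nil ↔ n ≠ 0 := by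
  cases n <;> simp [tag]

namespace PolyTime

variable {f g : Data → Data}

@[fun_prop]
theorem append (hf : PolyTime f) (hg : PolyTime g) : PolyTime fun x => (f x).append (g x) :=
  treeRec (fun e d => d.append e) (base := fun e => e)
    (h := fun z => .cons z.tl.hd.hd z.tl.tl.tl) (by fun_prop) (by fun_prop)
    (fun _ => rfl) (fun _ _ _ => rfl) .X (fun e d => by simp [Data.size_append, add_comm]) hg hf

@[fun_prop]
theorem tag_size (hf : PolyTime f) : PolyTime fun x => tag (f x).size :=
  treeRec (fun _ d => tag d.size) (base := fun _ => .nil)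
    (h := fun z => .cons .nil (z.tl.tl.hd.append z.tl.tl.tl)) (by fun_prop) (by fun_prop)
    (fun _ => rfl) (fun _ _ _ => by simp [Data.hd, Data.tl, tag_append_tag, Data.size, tag]) .X
    (fun e d => by simp [size_tag]) (const .nil) hf

/-- Multiplication of unary numbers. -/
theorem tag_mul (hf : PolyTime f) (hg : PolyTime g) :
    PolyTime fun x => tag ((f x).size * (g x).size) := by
  let T : Data → Data → Data := fun e d => tag (d.toList.length * e.size)
  have hT : PolyTime fun x => T (g x) (tag (f x).size) :=
    treeRec T (base := fun _ => .nil)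
      (h := fun z => (tag z.hd.size).append z.tl.tl.tl) (by fun_prop) (by fun_prop)
      (fun _ => by simp [T, Data.toList, tag])
      (fun _ _ _ => by
        simp only [T, Data.hd, Data.tl, tag_append_tag, Data.toList, List.length_cons]
        congr 1; ring)
      (.X * .X)
      (fun e d => by
        have : d.toList.length ≤ d.size := by
          induction d with
          | nil => simp [Data.toList]
          | cons a b _ ih => simp only [Data.toList, List.length_cons, Data.size]; omega
        simp only [T, size_tag, Polynomial.eval_mul, Polynomial.eval_X]
        gcongr <;> omega) hg (by fun_prop)
  simpa [T, length_toList_tag] using hT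

/-- The value of a polynomial at the size of a tree is computed in polynomial time, in unary. -/
theorem tag_eval (q : Polynomial ℕ) (hf : PolyTime f) :
    PolyTime fun x => tag (q.eval (f x).size) := by
  induction q using Polynomial.induction_on with
  | C a => simpa using const _
  | add p q hp hq =>
    have := hp.append hq
    simpa [tag_append_tag] using this
  | monomial n a h =>
    have := h.tag_mul hf
    simpa [size_tag, pow_succ, mul_assoc] using this

/-- Subtraction of unary numbers. -/
theorem tag_sub (hf : PolyTime f) (hg : PolyTime g) :
    PolyTime fun x => tag ((f x).size - (g x).size) := by
  let T : Data → Data → Data := fun e d => tag (e.size - d.toList.length)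
  have hT : PolyTime fun x => T (f x) (tag (g x).size) :=
    treeRec T (base := fun e => tag e.size)
      (h := fun z => z.tl.tl.tl.tl) (by fun_prop) (by fun_prop)
      (fun _ => by simp [T, Data.toList])
      (fun e _ b => by
        simp only [T, Data.tl, Data.toList, List.length_cons, ← Nat.sub_sub]
        cases e.size - b.toList.length <;> simp [tag])
      .X
      (fun e d => by simp only [T, size_tag, Polynomial.eval_X]; omega) hf (by fun_prop)
  simpa [T, length_toList_tag] using hT

end PolyTime

/-- The predicate `P` is decidable in polynomial time. -/
def InP (P : Data → Prop) : Prop := {x | P x} ∈ ClassP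

theorem inP_iff {P : Data → Prop} :
    InP P ↔ ∃ f, PolyTime f ∧ ∀ x, f x ≠ .nil ↔ P x := by
  constructor
  · rintro ⟨p, q, h⟩
    choose f t h using h
    exact ⟨f, ⟨p, q, fun x => ⟨t x, (h x).1, (h x).2.1⟩⟩, fun x => (h x).2.2⟩
  · rintro ⟨f, ⟨p, q, h⟩, hf⟩
    refine ⟨p, q, fun x => ?_⟩
    obtain ⟨t, r, b⟩ := h x
    exact ⟨_, t, r, b, hf x⟩

namespace InP

variable {P Q : Data → Prop} {f g : Data → Data}

theorem comp (hP : InP P) (hf : PolyTime f) : InP fun x => P (f x) := by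
  obtain ⟨u, hu, h⟩ := inP_iff.1 hP
  exact inP_iff.2 ⟨_, hu.comp hf, fun x => h (f x)⟩

theorem ne_nil (hf : PolyTime f) : InP fun x => f x ≠ .nil :=
  inP_iff.2 ⟨f, hf, fun _ => Iff.rfl⟩

theorem congr (hP : InP P) (h : ∀ x, P x ↔ Q x) : InP Q := by
  rwa [← funext fun x => propext (h x)]

theorem not (hP : InP P) : InP fun x => ¬ P x := by
  obtain ⟨u, hu, h⟩ := inP_iff.1 hP
  refine inP_iff.2 ⟨fun x => .sel (u x) .nil .one, by fun_prop, fun x => ?_⟩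
  simp only [Data.sel, ← h x]
  split_ifs with h <;> simp [h, Data.one]

theorem and (hP : InP P) (hQ : InP Q) : InP fun x => P x ∧ Q x := by
  obtain ⟨u, hu, h⟩ := inP_iff.1 hP
  obtain ⟨v, hv, h'⟩ := inP_iff.1 hQ
  refine inP_iff.2 ⟨fun x => .sel (u x) (v x) .nil, by fun_prop, fun x => ?_⟩
  simp only [Data.sel, ← h x, ← h' x]
  split_ifs with h <;> simp [h]

theorem or (hP : InP P) (hQ : InP Q) : InP fun x => P x ∨ Q x := by
  simpa only [not_and_or, not_not] using (hP.not.and hQ.not).not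

theorem eq (hf : PolyTime f) (hg : PolyTime g) : InP fun x => f x = g x := by
  refine inP_iff.2 ⟨_, hf.eqTest hg, fun x => ?_⟩
  unfold Data.eqTest
  split_ifs with h <;> simp [h, Data.one]

/-- This is what makes it possible to verify the bound on the size of a witness. -/
theorem size_le (q : Polynomial ℕ) (hf : PolyTime f) (hg : PolyTime g) :
    InP fun x => (f x).size ≤ q.eval (g x).size := by
  have := (ne_nil ((hf.tag_sub (hg.tag_eval q)))).not
  simpa only [size_tag, tag_ne_nil, not_not, Nat.sub_eq_zero_iff_le] using this

theorem forall_mem {Q : Data → Data → Prop} (hQ : InP fun z => Q z.hd z.tl) (hf : PolyTime f) :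
    InP fun x => ∀ a ∈ (f x).toList, Q a x := by
  classical
  obtain ⟨u, hu, h⟩ := inP_iff.1 hQ
  let T : Data → Data → Data := fun e d => if ∀ a ∈ d.toList, Q a e then .one else .nil
  refine inP_iff.2 ⟨fun x => T x (f x), ?_, fun x => ?_⟩
  · refine PolyTime.treeRec T (base := fun _ => .one)
      (h := fun z => .sel (u (.cons z.tl.hd.hd z.hd)) z.tl.tl.tl .nil) (by fun_prop) (by fun_prop)
      (fun _ => by simp [T, Data.toList]) (fun e a b => ?_) 1 (fun e d => ?_) (by fun_prop) hf
    · have : u (.cons a e) ≠ .nil ↔ Q a e := h (.cons a e)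
      simp only [T, Data.hd, Data.tl, Data.toList, List.forall_mem_cons, ← this, Data.sel]
      by_cases hu : u (.cons a e) = .nil <;> simp [hu]
    · simp only [T]
      split_ifs <;> simp [Data.size, Data.one]
  · simp only [T]
    split_ifs with h
    · simpa [Data.one] using h
    · simpa using h

theorem exists_mem {Q : Data → Data → Prop} (hQ : InP fun z => Q z.hd z.tl) (hf : PolyTime f) :
    InP fun x => ∃ a ∈ (f x).toList, Q a x := by
  have := (forall_mem (Q := fun a x => ¬ Q a x) hQ.not hf).not
  simpa using this

end InP

/-! ### Closure properties of the polynomial hierarchy -/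

/-- The predicate `P` is in `Σₖᵖ`. -/
def Sig (k : ℕ) (P : Data → Prop) : Prop := {x | P x} ∈ SigmaP k

/-- The predicate `P` is in `Πₖᵖ`. -/
def Pi (k : ℕ) (P : Data → Prop) : Prop := Sig k fun x => ¬ P x

theorem Sig.congr {k : ℕ} {P Q : Data → Prop} (hP : Sig k P) (h : ∀ x, P x ↔ Q x) : Sig k Q := by
  rwa [← funext fun x => propext (h x)]

theorem Pi.congr {k : ℕ} {P Q : Data → Prop} (hP : Pi k P) (h : ∀ x, P x ↔ Q x) : Pi k Q := by
  rwa [← funext fun x => propext (h x)]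

theorem Sig.not {k : ℕ} {P : Data → Prop} (h : Sig k P) : Pi k fun x => ¬ P x := by
  simpa only [Pi, not_not] using h

theorem sig_succ {k : ℕ} {P : Data → Prop} : Sig (k + 1) P ↔ ∃ Q : Data → Prop, Pi k Q ∧
    ∃ q : Polynomial ℕ, ∀ x, P x ↔ ∃ y : Data, y.size ≤ q.eval x.size ∧ Q (.cons x y) :=
  Iff.rfl

/-- The closure properties of `Σₖᵖ` that are proved by a joint induction on `k`. -/
structure SigClosed (k : ℕ) : Prop where
  comp {P : Data → Prop} {f : Data → Data} : Sig k P → PolyTime f → Sig k fun x => P (f x)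
  and {P Q : Data → Prop} : Sig k P → Sig k Q → Sig k fun x => P x ∧ Q x
  or {P Q : Data → Prop} : Sig k P → Sig k Q → Sig k fun x => P x ∨ Q x
  of_inP {P : Data → Prop} : InP P → Sig k P

namespace SigClosed

variable {k : ℕ} {P : Data → Prop}

theorem pi_comp {f : Data → Data} (c : SigClosed k) (h : Pi k P) (hf : PolyTime f) :
    Pi k fun x => P (f x) :=
  c.comp h hf

theorem pi_and {Q : Data → Prop} (c : SigClosed k) (h : Pi k P) (h' : Pi k Q) :
    Pi k fun x => P x ∧ Q x := by
  simpa only [Pi, not_and_or] using c.or h h'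

theorem pi_or {Q : Data → Prop} (c : SigClosed k) (h : Pi k P) (h' : Pi k Q) :
    Pi k fun x => P x ∨ Q x := by
  simpa only [Pi, not_or] using c.and h h'

/-- The bound on the witness can be made a part of the predicate. -/
theorem exists_bounded (c : SigClosed k) (h : Sig (k + 1) P) : ∃ Q : Data → Data → Prop,
    Pi k (fun z => Q z.hd z.tl) ∧ (∀ x, P x ↔ ∃ y, Q x y) ∧
      ∃ q : Polynomial ℕ, ∀ x y, Q x y → y.size ≤ q.eval x.size := by
  obtain ⟨Q, hQ, q, h⟩ := sig_succ.1 h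
  refine ⟨fun x y => y.size ≤ q.eval x.size ∧ Q (.cons x y), ?_, h, q, fun _ _ h => h.1⟩
  exact c.pi_and (c.of_inP (InP.size_le q (by fun_prop) (by fun_prop)).not)
    (c.pi_comp hQ (by fun_prop))

theorem sig_of_exists {P : Data → Data → Prop} (hP : Pi k fun z => P z.hd z.tl)
    (q : Polynomial ℕ) (hq : ∀ x y, P x y → ∃ y', y'.size ≤ q.eval x.size ∧ P x y') :
    Sig (k + 1) fun x => ∃ y, P x y :=
  sig_succ.2 ⟨fun z => P z.hd z.tl, hP, q, fun x =>
    ⟨fun ⟨y, h⟩ => hq x y h, fun ⟨y, _, h⟩ => ⟨y, h⟩⟩⟩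

end SigClosed

theorem sigClosed (k : ℕ) : SigClosed k := by
  induction k with
  | zero => exact ⟨InP.comp, InP.and, InP.or, id⟩
  | succ k c =>
    refine ⟨fun {P f} hP hf => ?_, fun {P P'} hP hP' => ?_, fun {P P'} hP hP' => ?_,
      fun {P} hP => ?_⟩
    · obtain ⟨Q, hQ, e, q, b⟩ := c.exists_bounded hP
      obtain ⟨r, hr⟩ := hf.exists_size_le
      simp only [e]
      refine SigClosed.sig_of_exists (P := fun x y => Q (f x) y)
        (c.pi_comp (f := fun z => .cons (f z.hd) z.tl) hQ (by fun_prop))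
        (q.comp r) fun x y h => ⟨y, (b _ _ h).trans ?_, h⟩
      rw [Polynomial.eval_comp]
      exact eval_mono q (hr x)
    · obtain ⟨Q, hQ, e, q, b⟩ := c.exists_bounded hP
      obtain ⟨Q', hQ', e', q', b'⟩ := c.exists_bounded hP'
      -- The two witnesses are merged into a pair.
      have : (fun x => P x ∧ P' x) = fun x => ∃ y : Data, Q x y.hd ∧ Q' x y.tl := by
        funext x
        rw [e, e']
        exact propext ⟨fun ⟨⟨y, h⟩, y', h'⟩ => ⟨.cons y y', h, h'⟩,
          fun ⟨y, h, h'⟩ => ⟨⟨_, h⟩, _, h'⟩⟩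
      rw [this]
      refine SigClosed.sig_of_exists (P := fun x y => Q x y.hd ∧ Q' x y.tl)
        (c.pi_and (c.pi_comp (f := fun z => .cons z.hd z.tl.hd) hQ (by fun_prop))
          (c.pi_comp (f := fun z => .cons z.hd z.tl.tl) hQ' (by fun_prop)))
        (q + q' + 1) fun x y h => ⟨.cons y.hd y.tl, ?_, h⟩
      have := b _ _ h.1
      have := b' _ _ h.2
      simp only [Data.size, Polynomial.eval_add, Polynomial.eval_one]
      omega
    · obtain ⟨Q, hQ, e, q, b⟩ := c.exists_bounded hP
      obtain ⟨Q', hQ', e', q', b'⟩ := c.exists_bounded hP'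
      simp only [e, e', ← exists_or]
      refine SigClosed.sig_of_exists (P := fun x y => Q x y ∨ Q' x y) (c.pi_or hQ hQ')
        (q + q') fun x y h => ⟨y, ?_, h⟩
      rw [Polynomial.eval_add]
      exact h.elim (fun h => by have := b _ _ h; omega) fun h => by have := b' _ _ h; omega
    · exact sig_succ.2 ⟨fun z => P z.hd, c.of_inP (hP.not.comp PolyTime.hd), 0,
        fun x => ⟨fun h => ⟨.nil, by simp [Data.size], h⟩, fun ⟨_, _, h⟩ => h⟩⟩

theorem InP.sig {P : Data → Prop} (h : InP P) (k : ℕ) : Sig k P := (sigClosed k).of_inP h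

theorem InP.pi {P : Data → Prop} (h : InP P) (k : ℕ) : Pi k P := (sigClosed k).of_inP h.not

namespace Sig

variable {k : ℕ} {P Q : Data → Prop} {f : Data → Data}

theorem comp (h : Sig k P) (hf : PolyTime f) : Sig k fun x => P (f x) := (sigClosed k).comp h hf

theorem and (h : Sig k P) (h' : Sig k Q) : Sig k fun x => P x ∧ Q x := (sigClosed k).and h h'

end Sig

namespace Pi

variable {k : ℕ} {P Q : Data → Prop} {f : Data → Data}

theorem comp (h : Pi k P) (hf : PolyTime f) : Pi k fun x => P (f x) := (sigClosed k).pi_comp h hf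

theorem and (h : Pi k P) (h' : Pi k Q) : Pi k fun x => P x ∧ Q x := (sigClosed k).pi_and h h'

theorem sig_succ (h : Pi k P) : Sig (k + 1) P :=
  AbdForget.sig_succ.2 ⟨fun z => P z.hd, h.comp PolyTime.hd, 0,
    fun x => ⟨fun h => ⟨.nil, by simp [Data.size], h⟩, fun ⟨_, _, h⟩ => h⟩⟩

end Pi

theorem Sig.succ {k : ℕ} {P : Data → Prop} (h : Sig k P) : Sig (k + 1) P := by
  induction k generalizing P with
  | zero => exact InP.sig h 1
  | succ k ih =>
    obtain ⟨Q, hQ, q, e⟩ := AbdForget.sig_succ.1 h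
    exact AbdForget.sig_succ.2 ⟨Q, ih hQ, q, e⟩

theorem Pi.succ {k : ℕ} {P : Data → Prop} (h : Pi k P) : Pi (k + 1) P := Sig.succ h

theorem Sig.pi_succ {k : ℕ} {P : Data → Prop} (h : Sig k P) : Pi (k + 1) P := h.not.sig_succ

/-- The classes `Σₖᵖ` with `k > 0` are closed under existential quantification over witnesses of
polynomial size. -/
theorem Sig.exists {k : ℕ} {P : Data → Data → Prop} (hP : Sig (k + 1) fun z => P z.hd z.tl)
    (q : Polynomial ℕ) (hq : ∀ x y, P x y → ∃ y', y'.size ≤ q.eval x.size ∧ P x y') :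
    Sig (k + 1) fun x => ∃ y, P x y := by
  have c := sigClosed k
  obtain ⟨Q, hQ, e, r, b⟩ := c.exists_bounded hP
  have e' (x y : Data) : P x y ↔ ∃ w, Q (.cons x y) w := e (.cons x y)
  have : (fun x => ∃ y, P x y) = fun x => ∃ u : Data, Q (.cons x u.hd) u.tl := by
    funext x
    simp only [e']
    exact propext ⟨fun ⟨y, w, h⟩ => ⟨.cons y w, h⟩, fun ⟨u, h⟩ => ⟨_, _, h⟩⟩
  rw [this]
  refine SigClosed.sig_of_exists (P := fun x u => Q (.cons x u.hd) u.tl)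
    (c.pi_comp (f := fun z => .cons (.cons z.hd z.tl.hd) z.tl.tl) hQ (by fun_prop))
    (q + r.comp (.X + q + 1) + 1) fun x u h => ?_
  obtain ⟨y, hy, h⟩ := hq x u.hd ((e' _ _).2 ⟨_, h⟩)
  obtain ⟨w, h⟩ := (e' _ _).1 h
  refine ⟨.cons y w, ?_, h⟩
  have h₁ := b _ _ h
  have h₂ := eval_mono r (show (Data.cons x y).size ≤ x.size + q.eval x.size + 1 by
    simp only [Data.size]; omega)
  simp only [Data.size, Polynomial.eval_add, Polynomial.eval_comp, Polynomial.eval_one,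
    Polynomial.eval_X] at *
  omega

theorem Data.size_le_of_mem {a d : Data} (h : a ∈ d.toList) : a.size ≤ d.size := by
  induction d with
  | nil => simp [toList] at h
  | cons b c _ ih =>
    simp only [toList, List.mem_cons] at h
    rcases h with rfl | h
    · simp only [size]; omega
    · have := ih h
      simp only [size]; omega

/-- The classes `Πₖᵖ` are closed under universal quantification over the elements of a list. For
`k > 0` the quantifier merges with the outermost one. -/
theorem Pi.forall_mem {k : ℕ} {P : Data → Data → Prop} {f : Data → Data}
    (hP : Pi k fun z => P z.hd z.tl) (hf : PolyTime f) :
    Pi k fun x => ∀ a ∈ (f x).toList, P a x := by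
  cases k with
  | zero => exact (InP.forall_mem (InP.not hP |>.congr fun _ => not_not) hf).not
  | succ k =>
    obtain ⟨r, hr⟩ := hf.exists_size_le
    have := Sig.exists (P := fun x a => a ∈ (f x).toList ∧ ¬ P a x) (k := k)
      (Sig.and ((InP.exists_mem (Q := fun b z => b = z.tl) (f := fun z => f z.hd)
        (InP.eq (by fun_prop) (by fun_prop)) (by fun_prop)).congr (by simp) |>.sig _)
        (Sig.comp (f := fun z => .cons z.tl z.hd) hP (by fun_prop))) r
      fun x a h => ⟨a, (Data.size_le_of_mem h.1).trans (hr x), h⟩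
    simpa [Pi] using this

/-- The classes `Σₖᵖ` with `k > 0` are closed under universal quantification over the elements of a
list: the list of all pairs of an element and its witness is the new witness. -/
theorem Sig.forall_mem {k : ℕ} {P : Data → Data → Prop} {f : Data → Data}
    (hP : Sig (k + 1) fun z => P z.hd z.tl) (hf : PolyTime f) :
    Sig (k + 1) fun x => ∀ a ∈ (f x).toList, P a x := by
  obtain ⟨Q, hQ, e, q, b⟩ := (sigClosed k).exists_bounded hP
  have e' (a x : Data) : P a x ↔ ∃ w, Q (.cons a x) w := e (.cons a x)
  obtain ⟨r, hr⟩ := hf.exists_size_le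
  -- `R x d W`: the list `W` contains a witness for each element of `d`, and only correct pairs.
  let R : Data → Data → Data → Prop := fun x d W =>
    (∀ a ∈ d.toList, ∃ t ∈ W.toList, t.hd = a) ∧ ∀ t ∈ W.toList, Q (.cons t.hd x) t.tl
  -- `B` bounds the size of a witness for an element of `f x` in terms of the size of `x`.
  let B : Polynomial ℕ := q.comp (r + .X + 1)
  have small (x : Data) (h : ∀ a ∈ (f x).toList, P a x) :
      ∃ W : Data, W.size ≤ ((B + 2) * r).eval x.size ∧ R x (f x) W := by
    suffices ∀ d : Data, (∀ a ∈ d.toList, P a x) → d.size ≤ (f x).size →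
        ∃ W : Data, W.size ≤ (B.eval x.size + 2) * d.size ∧ R x d W by
      obtain ⟨W, hW, h⟩ := this (f x) h le_rfl
      refine ⟨W, hW.trans ?_, h⟩
      simp only [Polynomial.eval_mul, Polynomial.eval_add, Polynomial.eval_ofNat]
      gcongr
      exact hr x
    intro d hd hs
    induction d with
    | nil => exact ⟨.nil, by simp [Data.size], by simp [R, Data.toList]⟩
    | cons a d _ ih =>
      simp only [Data.toList, List.forall_mem_cons, Data.size] at hd hs
      obtain ⟨W, hW, h₁, h₂⟩ := ih hd.2 (by omega)
      obtain ⟨w, hw⟩ := (e' _ _).1 hd.1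
      refine ⟨.cons (.cons a w) W, ?_, ?_, ?_⟩
      · have := hr x
        have h₃ := (b _ _ hw).trans (eval_mono q (show (Data.cons a x).size ≤
          r.eval x.size + x.size + 1 by simp only [Data.size]; omega))
        have h₄ : B.eval x.size = q.eval (r.eval x.size + x.size + 1) := by simp [B]
        simp only [Data.size]
        nlinarith
      · simp only [Data.toList, List.forall_mem_cons, List.exists_mem_cons_iff]
        exact ⟨.inl rfl, fun c hc => .inr (h₁ c hc)⟩
      · simp only [Data.toList, List.forall_mem_cons]
        exact ⟨hw, h₂⟩
  have : (fun x => ∀ a ∈ (f x).toList, P a x) = fun x => ∃ W, R x (f x) W := by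
    funext x
    refine propext ⟨fun h => (small x h).imp fun _ h => h.2, fun ⟨W, h₁, h₂⟩ a ha => ?_⟩
    obtain ⟨t, ht, rfl⟩ := h₁ a ha
    exact (e' _ _).2 ⟨_, h₂ t ht⟩
  rw [this]
  refine SigClosed.sig_of_exists (P := fun x W => R x (f x) W) (Pi.and (InP.pi ?_ k) ?_)
    ((B + 2) * r) fun x W h => small x (congrFun this x ▸ ⟨W, h⟩)
  · exact InP.forall_mem (f := fun z => f z.hd) (Q := fun a z => ∃ t ∈ z.tl.toList, t.hd = a)
      (InP.exists_mem (f := fun z => z.tl.tl) (Q := fun t z => t.hd = z.hd)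
        (InP.eq (by fun_prop) (by fun_prop)) (by fun_prop)) (by fun_prop)
  · exact Pi.forall_mem (f := fun z => z.tl) (P := fun t z => Q (.cons t.hd z.hd) t.tl)
      (Pi.comp (f := fun z => .cons (.cons z.hd.hd z.tl.hd) z.hd.tl) hQ (by fun_prop))
      (by fun_prop)

/-! ### Decoding variables, sets and formulae -/

/-- The variable that a tree stands for. Every tree is given a meaning, so that predicates of
variables, sets and formulae are predicates of trees. -/
def decVar : Data → Var
  | .nil => []
  | .cons a b => decide (a ≠ .nil) :: decVar b

@[simp]
theorem decVar_encodeVar (v : Var) : decVar (encodeVar v) = v := by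
  induction v with
  | nil => rfl
  | cons b v ih => cases b <;> simpa [encodeVar, encodeList, decVar, encodeBit] using ih

/-- The set of variables that a tree, read as a list, stands for. -/
def vset (d : Data) : Finset Var := (d.toList.map decVar).toFinset

theorem mem_vset {v : Var} {d : Data} : v ∈ vset d ↔ ∃ a ∈ d.toList, decVar a = v := by
  simp [vset]

@[simp]
theorem vset_nil : vset .nil = ∅ := rfl

@[simp]
theorem vset_cons (a b : Data) : vset (.cons a b) = insert (decVar a) (vset b) := by
  simp [vset, Data.toList]

@[simp]
theorem vset_append (a b : Data) : vset (a.append b) = vset a ∪ vset b := by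
  simp [vset, Data.toList_append]

/-- The regular encoding of the list of variables that a tree stands for. -/
def normList (d : Data) : Data := encodeList encodeVar (d.toList.map decVar)

theorem encodesSet_normList (d : Data) : EncodesSet (normList d) (vset d) := ⟨_, rfl, rfl⟩

@[simp]
theorem vset_normList (d : Data) : vset (normList d) = vset d := by
  unfold vset normList
  generalize d.toList.map decVar = l
  congr 1
  induction l with
  | nil => rfl
  | cons v l ih => simp [encodeList, Data.toList, ih]

theorem encodesSet_iff {d : Data} {s : Finset Var} :
    EncodesSet d s ↔ normList d = d ∧ vset d = s := by
  constructor
  · rintro ⟨l, rfl, rfl⟩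
    have : (encodeList encodeVar l).toList.map decVar = l := by
      induction l with
      | nil => rfl
      | cons v l ih => simp [encodeList, Data.toList, ih]
    simp [normList, vset, this]
  · rintro ⟨h, rfl⟩
    have := encodesSet_normList d
    rwa [h] at this

/-- Every subset of a represented set is represented by a tree that is not larger. -/
theorem exists_vset_eq {s : Finset Var} {d : Data} (h : s ⊆ vset d) :
    ∃ y : Data, y.size ≤ d.size ∧ vset y = s := by
  induction d generalizing s with
  | nil => exact ⟨.nil, le_rfl, by simpa [eq_comm] using h⟩
  | cons a b _ ih =>
    obtain ⟨y, hy, e⟩ := ih (s := s.erase (decVar a)) (by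
      rw [vset_cons] at h
      exact Finset.subset_insert_iff.1 h)
    by_cases ha : decVar a ∈ s
    · exact ⟨.cons a y, by simp only [Data.size]; omega, by simp [e, ha]⟩
    · exact ⟨y, by simp only [Data.size]; omega, by rwa [Finset.erase_eq_of_notMem ha] at e⟩

theorem Data.size_hd_le (d : Data) : d.hd.size ≤ d.size := by
  cases d <;> simp only [hd, size, le_refl]; omega

theorem Data.size_tl_le (d : Data) : d.tl.size ≤ d.size := by
  cases d <;> simp only [tl, size, le_refl]; omega

/-- The formula that a tree stands for; a tree that is no syntax tree stands for `fls` at the places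
where it fails to be one. -/
def decF : Data → PropFormula
  | .nil => .fls
  | .cons a b =>
    if a = tag 1 then .var (decVar b)
    else if a = tag 2 then .neg (decF b)
    else if a = tag 3 then .and (decF b.hd) (decF b.tl)
    else if a = tag 4 then .or (decF b.hd) (decF b.tl)
    else if a = tag 5 then .imp (decF b.hd) (decF b.tl)
    else .fls
termination_by d => d.size
decreasing_by all_goals (have := b.size_hd_le; have := b.size_tl_le; simp only [Data.size]; omega)

theorem tag_injective : Function.Injective tag := fun m n h => by
  simpa [size_tag] using congrArg Data.size h

@[simp]
theorem tag_inj {m n : ℕ} : tag m = tag n ↔ m = n := tag_injective.eq_iff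

@[simp]
theorem decF_encodeFormula (A : PropFormula) : decF (encodeFormula A) = A := by
  induction A <;> simp_all [encodeFormula, decF, Data.hd, Data.tl]

/-- The variables of a formula. -/
def PropFormula.vars : PropFormula → Finset Var
  | fls => ∅
  | var v => {v}
  | neg A => A.vars
  | and A B => A.vars ∪ B.vars
  | or A B => A.vars ∪ B.vars
  | imp A B => A.vars ∪ B.vars

theorem PropFormula.eval_congr {A : PropFormula} {v w : Var → Bool}
    (h : ∀ x ∈ A.vars, v x = w x) : A.eval v = A.eval w := by
  induction A <;> simp_all [vars, eval]

theorem exists_vars_subset (d : Data) : ∃ u : Data, u.size ≤ d.size ∧ (decF d).vars ⊆ vset u := by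
  induction hn : d.size using Nat.strong_induction_on generalizing d with
  | _ n ih =>
    subst hn
    cases d with
    | nil => exact ⟨.nil, le_rfl, by simp [decF, PropFormula.vars]⟩
    | cons a b =>
      have hb : b.hd.size + b.tl.size ≤ b.size := by
        cases b <;> simp only [Data.hd, Data.tl, Data.size] <;> omega
      simp only [Data.size] at ih ⊢
      obtain ⟨u, hu, su⟩ := ih _ (by omega) b rfl
      obtain ⟨u₁, hu₁, su₁⟩ := ih _ (by omega) b.hd rfl
      obtain ⟨u₂, hu₂, su₂⟩ := ih _ (by omega) b.tl rfl
      have su' := Finset.union_subset_union su₁ su₂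
      have hu' : (u₁.append u₂).size ≤ a.size + b.size + 1 := by rw [Data.size_append]; omega
      rw [← vset_append] at su'
      rw [decF]
      split_ifs
      · exact ⟨.cons b .nil, by simp only [Data.size]; omega, by simp [PropFormula.vars]⟩
      · exact ⟨u, by omega, su⟩
      · exact ⟨_, hu', su'⟩
      · exact ⟨_, hu', su'⟩
      · exact ⟨_, hu', su'⟩
      · exact ⟨.nil, by simp [Data.size], by simp [PropFormula.vars]⟩

/-- The truth assignment that makes exactly the variables in a set true. -/
def ofSet (s : Finset Var) : Var → Bool := fun v => decide (v ∈ s)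

/-- As far as a formula and a set of variables are concerned, a truth assignment is represented by
a small set of variables. -/
theorem exists_vset_ofSet (d e : Data) (v : Var → Bool) :
    ∃ y : Data, y.size ≤ d.size + e.size ∧ (decF d).eval (ofSet (vset y)) = (decF d).eval v ∧
      ∀ x ∈ vset e, ofSet (vset y) x = v x := by
  obtain ⟨u, hu, su⟩ := exists_vars_subset d
  obtain ⟨y, hy, e'⟩ := exists_vset_eq (s := (vset (u.append e)).filter (v · = true))
    (Finset.filter_subset ..)
  have key (x : Var) (hx : x ∈ vset (u.append e)) : ofSet (vset y) x = v x := by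
    rw [Bool.eq_iff_iff, ofSet, decide_eq_true_iff, e', Finset.mem_filter]
    exact and_iff_right hx
  rw [vset_append] at key
  rw [Data.size_append] at hy
  exact ⟨y, by omega, PropFormula.eval_congr fun x hx => key x (Finset.mem_union_left _ (su hx)),
    fun x hx => key x (Finset.mem_union_right _ hx)⟩

/-! ### Polynomial-time predicates of variables, sets and formulae -/

section

variable {f g : Data → Data}

theorem size_encodeVar_decVar (d : Data) : (encodeVar (decVar d)).size ≤ 2 * d.size := by
  induction d with
  | nil => simp [encodeVar, decVar, encodeList, Data.size]
  | cons a b _ ih =>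
    have hc : (encodeBit (decide (a ≠ .nil))).size ≤ 1 := by
      cases decide (a ≠ .nil) <;> simp [encodeBit, Data.size]
    simp [encodeVar, decVar, encodeList, Data.size] at ih hc ⊢
    omega

theorem size_normList (d : Data) : (normList d).size ≤ 2 * d.size := by
  induction d with
  | nil => simp [normList, Data.toList, encodeList, Data.size]
  | cons a b _ ih =>
    have := size_encodeVar_decVar a
    simp [normList, Data.toList, encodeList, Data.size] at ih ⊢
    omega

theorem PolyTime.encodeVar_decVar (hf : PolyTime f) : PolyTime fun x => encodeVar (decVar (f x)) :=
  treeRec (fun _ d => encodeVar (decVar d)) (base := fun _ => .nil)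
    (h := fun z => .cons (.sel z.tl.hd.hd .one .nil) z.tl.tl.tl) (by fun_prop) (by fun_prop)
    (fun _ => rfl)
    (fun _ a _ => by
      cases a <;> simp [encodeVar, decVar, encodeList, encodeBit, Data.one])
    (2 * .X)
    (fun e d => by
      have := size_encodeVar_decVar d
      simp only [Polynomial.eval_mul, Polynomial.eval_ofNat, Polynomial.eval_X]
      omega)
    (const .nil) hf

theorem PolyTime.normList (hf : PolyTime f) : PolyTime fun x => normList (f x) := by
  have hv := encodeVar_decVar (f := fun z => z.tl.hd.hd) (by fun_prop)
  exact treeRec (fun _ d => AbdForget.normList d) (base := fun _ => .nil)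
    (h := fun z => .cons (encodeVar (decVar z.tl.hd.hd)) z.tl.tl.tl) (by fun_prop) (by fun_prop)
    (fun _ => rfl) (fun _ _ _ => rfl) (2 * .X)
    (fun e d => by
      have := size_normList d
      simp only [Polynomial.eval_mul, Polynomial.eval_ofNat, Polynomial.eval_X]
      omega)
    (const .nil) hf

namespace InP

theorem mem_vset (hf : PolyTime f) (hg : PolyTime g) : InP fun x => decVar (f x) ∈ vset (g x) := by
  have := exists_mem (Q := fun a x => encodeVar (decVar a) = encodeVar (decVar (f x))) (f := g)
    (InP.eq (PolyTime.encodeVar_decVar (by fun_prop)) (PolyTime.encodeVar_decVar (by fun_prop))) hg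
  refine this.congr fun x => ?_
  rw [AbdForget.mem_vset]
  refine exists_congr fun a => and_congr_right fun _ => ⟨fun h => ?_, fun h => by rw [h]⟩
  simpa using congrArg decVar h

theorem forall_vset {P : Var → Data → Prop} (hP : InP fun z => P (decVar z.hd) z.tl)
    (hf : PolyTime f) : InP fun x => ∀ v ∈ vset (f x), P v x :=
  (forall_mem (Q := fun a x => P (decVar a) x) hP hf).congr fun x => by simp [AbdForget.mem_vset]

theorem subset (hf : PolyTime f) (hg : PolyTime g) : InP fun x => vset (f x) ⊆ vset (g x) :=
  forall_vset (P := fun v x => v ∈ vset (g x)) (mem_vset (by fun_prop) (by fun_prop)) hf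

theorem disjoint (hf : PolyTime f) (hg : PolyTime g) :
    InP fun x => Disjoint (vset (f x)) (vset (g x)) :=
  (forall_vset (P := fun v x => v ∉ vset (g x)) (mem_vset (by fun_prop) (by fun_prop)).not hf).congr
    fun _ => Finset.disjoint_left.symm

theorem nonempty (hf : PolyTime f) : InP fun x => (vset (f x)).Nonempty :=
  (ne_nil hf).congr fun x => by cases f x <;> simp

theorem lt {lt : Finset Var → Finset Var → Prop} (h : compareProblem lt ∈ ClassP)
    (hf : PolyTime f) (hg : PolyTime g) : InP fun x => lt (vset (f x)) (vset (g x)) := by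
  refine (InP.comp h (hf.normList.cons hg.normList)).congr fun x => ?_
  constructor
  · rintro ⟨a, b, E', E, e, ha, hb, hl⟩
    obtain ⟨rfl, rfl⟩ := Data.cons.inj e
    obtain ⟨-, rfl⟩ := encodesSet_iff.1 ha
    obtain ⟨-, rfl⟩ := encodesSet_iff.1 hb
    simpa using hl
  · exact fun hl => ⟨_, _, _, _, rfl, encodesSet_normList _, encodesSet_normList _, hl⟩

/-- A predicate is decidable in polynomial time if its value at a tree is obtained from those at
the second component and at the components of the latter. This is the recursion along the
syntax trees of formulae. -/
theorem formulaRec {V : Data → Data → Prop} {B G : Data → Prop} (hB : InP B) (hG : InP G)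
    (V_nil : ∀ e, V e .nil ↔ B e)
    (V_cons : ∀ e a b u v w : Data, (u ≠ .nil ↔ V e b) → (v ≠ .nil ↔ V e b.hd) →
      (w ≠ .nil ↔ V e b.tl) →
      (V e (.cons a b) ↔ G (.cons e (.cons (.cons a b) (.cons u (.cons v w))))))
    (hf : PolyTime f) (hg : PolyTime g) : InP fun x => V (f x) (g x) := by
  classical
  obtain ⟨ub, hub, eb⟩ := inP_iff.1 hB
  obtain ⟨ug, hug, eg⟩ := inP_iff.1 hG
  let V' : Data → Data → Data := fun e d => if V e d then .one else .nil
  have hV' (e d : Data) : V' e d ≠ .nil ↔ V e d := by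
    simp only [V']; split_ifs with h <;> simp [h, Data.one]
  let T : Data → Data → Data := fun e d => .cons (V' e d) (.cons (V' e d.hd) (V' e d.tl))
  have hT : PolyTime fun x => T (f x) (g x) := by
    refine PolyTime.treeRec T
      (base := fun e => .cons (.sel (ub e) .one .nil)
        (.cons (.sel (ub e) .one .nil) (.sel (ub e) .one .nil)))
      (h := fun z => .cons
        (.sel (ug (.cons z.hd (.cons z.tl.hd z.tl.tl.tl))) .one .nil)
        (.cons z.tl.tl.hd.hd z.tl.tl.tl.hd))
      (by fun_prop) (by fun_prop) (fun e => ?_) (fun e a b => ?_) 10 (fun e d => ?_) hf hg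
    · simp only [T, V', Data.hd, Data.tl, V_nil, ← eb, Data.sel]
      split_ifs <;> simp_all
    · have := V_cons e a b _ _ _ (hV' _ _) (hV' _ _) (hV' _ _)
      rw [← eg] at this
      simp only [T, Data.hd, Data.tl, Data.sel]
      congr 1
      simp only [V', this, ite_not]
      congr
    · have (d : Data) : (V' e d).size ≤ 1 := by
        simp only [V']; split_ifs <;> simp [Data.size, Data.one]
      have h₁ := this d
      have h₂ := this d.hd
      have h₃ := this d.tl
      simp only [T, Data.size, Polynomial.eval_ofNat]
      omega
  refine (ne_nil (PolyTime.hd.comp hT)).congr fun x => ?_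
  simp [T, Data.hd, hV']

theorem eval (hf : PolyTime f) (hg : PolyTime g) :
    InP fun x => (decF (f x)).eval (ofSet (vset (g x))) = true := by
  refine formulaRec (V := fun e d => (decF d).eval (ofSet (vset e)) = true)
    (B := fun _ => Data.nil = Data.one)
    (G := fun z => (z.tl.hd.hd = tag 1 ∧ decVar z.tl.hd.tl ∈ vset z.hd) ∨
      (z.tl.hd.hd = tag 2 ∧ z.tl.tl.hd = .nil) ∨
      (z.tl.hd.hd = tag 3 ∧ z.tl.tl.tl.hd ≠ .nil ∧ z.tl.tl.tl.tl ≠ .nil) ∨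
      (z.tl.hd.hd = tag 4 ∧ (z.tl.tl.tl.hd ≠ .nil ∨ z.tl.tl.tl.tl ≠ .nil)) ∨
      (z.tl.hd.hd = tag 5 ∧ (z.tl.tl.tl.hd = .nil ∨ z.tl.tl.tl.tl ≠ .nil)))
    ?_ ?_ ?_ ?_ hg hf
  · exact eq (by fun_prop) (by fun_prop)
  · refine .or (.and (eq ?_ ?_) (mem_vset ?_ ?_)) (.or (.and (eq ?_ ?_) (eq ?_ ?_))
      (.or (.and (eq ?_ ?_) (.and (ne_nil ?_) (ne_nil ?_))) (.or (.and (eq ?_ ?_)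
        (.or (ne_nil ?_) (ne_nil ?_))) (.and (eq ?_ ?_) (.or (eq ?_ ?_) (ne_nil ?_)))))) <;>
      fun_prop
  · simp [decF, PropFormula.eval, Data.one]
  · intro e a b u v w hu hv hw
    have hu' := not_iff_not.2 hu
    have hv' := not_iff_not.2 hv
    rw [not_not] at hu' hv'
    simp only [Data.hd_cons, Data.tl_cons, hu', hv', hv, hw]
    rw [decF]
    split_ifs with h₁ h₂ h₃ h₄ h₅ <;> simp_all [PropFormula.eval, ofSet]

theorem isFormula (hf : PolyTime f) : InP fun x => encodeFormula (decF (f x)) = f x := by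
  refine formulaRec (V := fun _ d => encodeFormula (decF d) = d)
    (B := fun _ => Data.nil = Data.one)
    (G := fun z => (z.tl.hd.hd = tag 1 ∧ encodeVar (decVar z.tl.hd.tl) = z.tl.hd.tl) ∨
      (z.tl.hd.hd = tag 2 ∧ z.tl.tl.hd ≠ .nil) ∨
      ((z.tl.hd.hd = tag 3 ∨ z.tl.hd.hd = tag 4 ∨ z.tl.hd.hd = tag 5) ∧ z.tl.hd.tl ≠ .nil ∧
        z.tl.tl.tl.hd ≠ .nil ∧ z.tl.tl.tl.tl ≠ .nil) ∨
      (Data.cons .nil .nil = z.tl.hd))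
    ?_ ?_ ?_ ?_ (.const .nil) hf
  · exact eq (by fun_prop) (by fun_prop)
  · refine .or (.and (eq ?_ ?_) (eq (.encodeVar_decVar ?_) ?_)) (.or (.and (eq ?_ ?_) (ne_nil ?_))
      (.or (.and (.or (eq ?_ ?_) (.or (eq ?_ ?_) (eq ?_ ?_))) (.and (ne_nil ?_) (.and (ne_nil ?_)
        (ne_nil ?_)))) (eq ?_ ?_))) <;> fun_prop
  · simp [decF, encodeFormula, Data.one]
  · intro e a b u v w hu hv hw
    have h0 (n : ℕ) : Data.nil = tag n ↔ n = 0 := (tag_inj (m := 0)).trans eq_comm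
    simp only [Data.hd_cons, Data.tl_cons, hu, hv, hw]
    rw [decF]
    split_ifs with h₁ h₂ h₃ h₄ h₅
    · subst h₁; simp [encodeFormula, h0]
    · subst h₂; simp [encodeFormula, h0]
    · subst h₃; cases b <;> simp [encodeFormula, h0]
    · subst h₄; cases b <;> simp [encodeFormula, h0]
    · subst h₅; cases b <;> simp [encodeFormula, h0]
    · simp [encodeFormula, h₁, h₂, h₃, h₄, h₅, show tag 0 = Data.nil from rfl]

end InP

end

/-! ### The complexity of abduction -/

section

variable {f g h d : Data → Data} {lt : Finset Var → Finset Var → Prop}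

/-- The classes `Σₖᵖ` with `k > 0` are closed under existential quantification over the
subsets of a given set. -/
theorem Sig.exists_subset {k : ℕ} {P : Finset Var → Data → Prop}
    (hP : Sig (k + 1) fun z => P (vset z.hd) z.tl) (hg : PolyTime g)
    (hs : ∀ s x, P s x → s ⊆ vset (g x)) : Sig (k + 1) fun x => ∃ s, P s x := by
  obtain ⟨q, hq⟩ := hg.exists_size_le
  refine (Sig.exists (P := fun x y => P (vset y) x) (hP.comp (f := fun z => .cons z.tl z.hd)
    (by fun_prop)) q fun x y h => ?_).congr fun x => ⟨fun ⟨y, h⟩ => ⟨_, h⟩, fun ⟨s, h⟩ => ?_⟩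
  · obtain ⟨y', hy, e⟩ := exists_vset_eq (hs _ _ h)
    exact ⟨y', hy.trans (hq x), e ▸ h⟩
  · obtain ⟨y, -, rfl⟩ := exists_vset_eq (hs _ _ h)
    exact ⟨y, h⟩

theorem Sig.forall_vset {k : ℕ} {P : Var → Data → Prop}
    (hP : Sig (k + 1) fun z => P (decVar z.hd) z.tl) (hf : PolyTime f) :
    Sig (k + 1) fun x => ∀ v ∈ vset (f x), P v x :=
  (Sig.forall_mem (P := fun a x => P (decVar a) x) hP hf).congr fun x => by simp [mem_vset]

theorem sig_consistent (hf : PolyTime f) (hg : PolyTime g) :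
    Sig 1 fun x => Consistent (decF (f x)) (vset (g x)) := by
  obtain ⟨p, hp⟩ := hf.exists_size_le
  obtain ⟨q, hq⟩ := hg.exists_size_le
  refine (Sig.exists (k := 0) (P := fun x y => (decF (f x)).eval (ofSet (vset y)) = true ∧
    vset (g x) ⊆ vset y) (InP.sig ?_ 1) (p + q) fun x y hxy => ?_).congr fun x => ?_
  · exact .and (.eval (by fun_prop) (by fun_prop)) (.subset (by fun_prop) (by fun_prop))
  · obtain ⟨y', hy, e, e'⟩ := exists_vset_ofSet (f x) (g x) (ofSet (vset y))
    refine ⟨y', ?_, e.trans hxy.1, fun v hv => ?_⟩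
    · rw [Polynomial.eval_add]
      exact hy.trans (add_le_add (hp x) (hq x))
    · have := e' v hv
      simp only [ofSet, decide_eq_decide] at this
      exact this.2 (hxy.2 hv)
  · constructor
    · rintro ⟨y, h₁, h₂⟩
      exact ⟨_, h₁, fun v hv => by simpa [ofSet] using h₂ hv⟩
    · rintro ⟨v, h₁, h₂⟩
      obtain ⟨y, -, e, e'⟩ := exists_vset_ofSet (f x) (g x) v
      refine ⟨y, e.trans h₁, fun w hw => ?_⟩
      simpa [ofSet, h₂ w hw] using e' w hw

theorem pi_entails (hf : PolyTime f) (hg : PolyTime g) (hh : PolyTime h) :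
    Pi 1 fun x => Entails (decF (f x)) (vset (g x)) (vset (h x)) := by
  obtain ⟨p, hp⟩ := hf.exists_size_le
  obtain ⟨q, hq⟩ := (hg.append hh).exists_size_le
  refine (Sig.exists (k := 0) (P := fun x y => (decF (f x)).eval (ofSet (vset y)) = true ∧
    vset (g x) ⊆ vset y ∧ ¬ vset (h x) ⊆ vset y) (InP.sig ?_ 1) (p + q) fun x y hxy => ?_).congr
      fun x => ?_
  · exact .and (.eval (by fun_prop) (by fun_prop))
      (.and (.subset (by fun_prop) (by fun_prop)) (.not (.subset (by fun_prop) (by fun_prop))))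
  · obtain ⟨y', hy, e, e'⟩ := exists_vset_ofSet (f x) ((g x).append (h x)) (ofSet (vset y))
    simp only [ofSet, decide_eq_decide, vset_append, Finset.mem_union] at e'
    refine ⟨y', ?_, e.trans hxy.1, fun v hv => (e' v (.inl hv)).2 (hxy.2.1 hv),
      fun hv => hxy.2.2 fun v hv' => (e' v (.inr hv')).1 (hv hv')⟩
    rw [Polynomial.eval_add]
    exact hy.trans (add_le_add (hp x) (hq x))
  · constructor
    · rintro ⟨y, h₁, h₂, h₃⟩ h₄
      refine h₃ fun v hv => ?_
      simpa [ofSet] using h₄ (ofSet (vset y)) ⟨h₁, fun v hv => by simpa [ofSet] using h₂ hv⟩ v hv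
    · intro h₁
      simp only [Entails, not_forall] at h₁
      obtain ⟨v, ⟨h₁, h₂⟩, m, hm, hv⟩ := h₁
      obtain ⟨y, -, e, e'⟩ := exists_vset_ofSet (f x) ((g x).append (h x)) v
      simp only [vset_append, Finset.mem_union] at e'
      refine ⟨y, e.trans h₁, fun w hw => ?_, fun hy => hv ?_⟩
      · simpa [ofSet, h₂ w hw] using e' w (.inl hw)
      · simpa [ofSet, hy hm] using (e' m (.inr hm)).symm

/-- The abduction frame that a tree stands for. Removing the hypotheses from the manifestations
makes this a frame for every tree; encodings of frames are not affected. -/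
def frameOf (d : Data) : AbductionFrame where
  formula := decF d.hd
  hyps := vset d.tl.hd
  manis := vset d.tl.tl.hd \ vset d.tl.hd
  disj := Finset.disjoint_sdiff

/-- The set of variables to remember that a tree stands for. -/
def rememberOf (d : Data) : Finset Var := vset d.tl.tl.tl

theorem inP_subset_manis (hd : PolyTime d) (hg : PolyTime g) :
    InP fun x => vset (g x) ⊆ (frameOf (d x)).manis :=
  (InP.and (.subset hg (g := fun x => (d x).tl.tl.hd) (by fun_prop))
    (.disjoint hg (g := fun x => (d x).tl.hd) (by fun_prop))).congr
      fun _ => Finset.subset_sdiff.symm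

theorem inP_subset_hyps (hd : PolyTime d) (hg : PolyTime g) :
    InP fun x => vset (g x) ⊆ (frameOf (d x)).hyps :=
  .subset hg (g := fun x => (d x).tl.hd) (by fun_prop)

theorem inP_subset_remember (hd : PolyTime d) (hg : PolyTime g) :
    InP fun x => vset (g x) ⊆ rememberOf (d x) :=
  .subset hg (g := fun x => (d x).tl.tl.tl) (by fun_prop)

theorem inP_disjoint_remember (hd : PolyTime d) (hg : PolyTime g) :
    InP fun x => Disjoint (vset (g x)) (rememberOf (d x)) :=
  .disjoint hg (g := fun x => (d x).tl.tl.tl) (by fun_prop)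

theorem frameOf_manis_subset (d : Data) : (frameOf d).manis ⊆ vset d.tl.tl.hd :=
  Finset.sdiff_subset

theorem mem_abduct {A : AbductionFrame} {E M : Finset Var} : (E, M) ∈ A.abduct ↔
    (E ⊆ A.hyps ∧ M ⊆ A.manis ∧ M.Nonempty) ∧ Consistent A.formula E ∧ Entails A.formula E M := by
  simp [AbductionFrame.abduct, and_assoc]

theorem inP_abduct_aux (hd : PolyTime d) (hf : PolyTime f) (hg : PolyTime g) :
    InP fun x => vset (f x) ⊆ (frameOf (d x)).hyps ∧ vset (g x) ⊆ (frameOf (d x)).manis ∧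
      (vset (g x)).Nonempty :=
  .and (inP_subset_hyps hd hf) (.and (inP_subset_manis hd hg) (.nonempty hg))

theorem sig_abduct (hd : PolyTime d) (hf : PolyTime f) (hg : PolyTime g) :
    Sig 2 fun x => (vset (f x), vset (g x)) ∈ (frameOf (d x)).abduct := by
  simp only [mem_abduct]
  exact .and ((inP_abduct_aux hd hf hg).sig 2) (.and
    (sig_consistent (f := fun x => (d x).hd) (by fun_prop) hf).succ
    (pi_entails (f := fun x => (d x).hd) (by fun_prop) hf hg).sig_succ)

theorem pi_abduct (hd : PolyTime d) (hf : PolyTime f) (hg : PolyTime g) :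
    Pi 2 fun x => (vset (f x), vset (g x)) ∈ (frameOf (d x)).abduct := by
  simp only [mem_abduct]
  exact .and ((inP_abduct_aux hd hf hg).pi 2) (.and
    (sig_consistent (f := fun x => (d x).hd) (by fun_prop) hf).pi_succ
    (pi_entails (f := fun x => (d x).hd) (by fun_prop) hf hg).succ)

/-- The quantifier over the hypothetical better explanations is a universal one, and supported
explanations are in `Σ₂ᵖ` as well as in `Π₂ᵖ`, so minimality costs no further alternation. -/
theorem pi_minabduct (hlt : compareProblem lt ∈ ClassP) (hd : PolyTime d) (hf : PolyTime f)
    (hg : PolyTime g) : Pi 2 fun x => (vset (f x), vset (g x)) ∈ (frameOf (d x)).minabduct lt := by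
  refine .and (pi_abduct hd hf hg) (Sig.not (.exists_subset (P := fun s x =>
    (s, vset (g x)) ∈ (frameOf (d x)).abduct ∧ lt s (vset (f x))) (g := fun x => (d x).tl.hd)
    (.and (sig_abduct ?_ ?_ ?_) ((InP.lt hlt ?_ ?_).sig 2)) ?_ fun s x h => h.1.1))
  all_goals fun_prop

theorem sig_focus (hlt : compareProblem lt ∈ ClassP) (hd : PolyTime d) (hf : PolyTime f)
    (hg : PolyTime g) :
    Sig 3 fun x => (vset (f x), vset (g x)) ∈ (frameOf (d x)).focus lt (rememberOf (d x)) := by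
  have key : Sig 3 fun x => ∃ E', (E' ⊆ (frameOf (d x)).hyps ∧ Disjoint E' (rememberOf (d x))) ∧
      ∃ M', (M' ⊆ (frameOf (d x)).manis ∧ Disjoint M' (rememberOf (d x))) ∧
      (vset (f x) ∪ E', vset (g x) ∪ M') ∈ (frameOf (d x)).minabduct lt := by
    refine .exists_subset (P := fun E' x =>
      (E' ⊆ (frameOf (d x)).hyps ∧ Disjoint E' (rememberOf (d x))) ∧
      ∃ M', (M' ⊆ (frameOf (d x)).manis ∧ Disjoint M' (rememberOf (d x))) ∧
      (vset (f x) ∪ E', vset (g x) ∪ M') ∈ (frameOf (d x)).minabduct lt)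
      (g := fun x => (d x).tl.hd) (.and (InP.sig (.and (inP_subset_hyps ?_ ?_)
        (inP_disjoint_remember ?_ ?_)) _) (.exists_subset (P := fun M' z =>
      (M' ⊆ (frameOf (d z.tl)).manis ∧ Disjoint M' (rememberOf (d z.tl))) ∧
      (vset (f z.tl) ∪ vset z.hd, vset (g z.tl) ∪ M') ∈ (frameOf (d z.tl)).minabduct lt)
      (g := fun z => (d z.tl).tl.tl.hd) (.and (InP.sig (.and (inP_subset_manis ?_ ?_)
        (inP_disjoint_remember ?_ ?_)) _) (Pi.sig_succ ?_)) ?_ ?_)) ?_ fun s x h => h.1.1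
    any_goals fun_prop
    · simp only [← vset_append]
      apply pi_minabduct hlt <;> fun_prop
    · exact fun s x h => h.1.1.trans (frameOf_manis_subset _)
  refine (Sig.and (InP.sig (.and (inP_subset_hyps hd hf) (.and (inP_subset_remember hd hf)
    (.and (inP_subset_manis hd hg) (.and (inP_subset_remember hd hg) (.nonempty hg))))) 3)
      key).congr fun x => ?_
  simp only [AbductionFrame.focus, Set.mem_ofPred_eq, Finset.subset_inter_iff, Finset.subset_sdiff]
  tauto

theorem sig_summarize (hlt : compareProblem lt ∈ ClassP) (hd : PolyTime d) (hf : PolyTime f)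
    (hg : PolyTime g) :
    Sig 3 fun x => (vset (f x), vset (g x)) ∈ (frameOf (d x)).summarize lt (rememberOf (d x)) := by
  have key : Sig 3 fun x => ∃ E', (E' ⊆ (frameOf (d x)).hyps ∧ Disjoint E' (rememberOf (d x))) ∧
      (vset (f x) ∪ E', vset (g x)) ∈ (frameOf (d x)).minabduct lt := by
    refine .exists_subset (P := fun E' x =>
      (E' ⊆ (frameOf (d x)).hyps ∧ Disjoint E' (rememberOf (d x))) ∧
      (vset (f x) ∪ E', vset (g x)) ∈ (frameOf (d x)).minabduct lt)
      (g := fun x => (d x).tl.hd) (.and (InP.sig (.and (inP_subset_hyps ?_ ?_)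
        (inP_disjoint_remember ?_ ?_)) _) (Pi.sig_succ ?_)) ?_ fun s x h => h.1.1
    any_goals fun_prop
    simp only [← vset_append]
    apply pi_minabduct hlt <;> fun_prop
  refine (Sig.and (InP.sig (.and (inP_subset_hyps hd hf) (.and (inP_subset_remember hd hf)
    (.and (inP_subset_manis hd hg) (inP_subset_remember hd hg)))) 3)
      key).congr fun x => ?_
  simp only [AbductionFrame.summarize, Set.mem_ofPred_eq, Finset.subset_inter_iff,
    Finset.subset_sdiff]
  tauto

end

/-! ### Which sets of explanations are the minimal ones of a formula -/

/-- The least set of explanations that contains `S` and is the set of all explanations supported by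
some formula: `E` is consistent if it is contained in an explaining set of `S`, and it entails
what its subsets explain according to `S`. -/
def leastAbduct (S : Set Explanation) : Set Explanation :=
  {x | x.2.Nonempty ∧ (∃ E, x.1 ⊆ E ∧ ∃ M, (E, M) ∈ S) ∧
    ∀ m ∈ x.2, ∃ E ⊆ x.1, ∃ M, m ∈ M ∧ (E, M) ∈ S}

/-- No explanation of `S` is beaten by one of `leastAbduct S`. -/
def Unbeaten (lt : Finset Var → Finset Var → Prop) (S : Set Explanation) : Prop :=
  ∀ E M, (E, M) ∈ S → ¬ ∃ E', lt E' E ∧ (E', M) ∈ leastAbduct S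

/-- Every explanation of `leastAbduct S` is in `S`, or is beaten by one that is. -/
def Dominating (lt : Finset Var → Finset Var → Prop) (S : Set Explanation) : Prop :=
  ∀ E M, (E, M) ∈ leastAbduct S → ∃ E', (E' = E ∨ lt E' E) ∧ (E', M) ∈ S

/-- Every property of the set of true variables among `s` is expressed by a formula. -/
theorem exists_formula (s : Finset Var) (p : Finset Var → Prop) :
    ∃ G : PropFormula, ∀ v, G.eval v = true ↔ p (s.filter (v · = true)) := by
  induction s using Finset.induction_on generalizing p with
  | empty =>
    by_cases h : p ∅
    · exact ⟨.neg .fls, fun v => by simp [PropFormula.eval, h]⟩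
    · exact ⟨.fls, fun v => by simp [PropFormula.eval, h]⟩
  | insert a s _ ih =>
    obtain ⟨G, hG⟩ := ih p
    obtain ⟨G', hG'⟩ := ih fun t => p (insert a t)
    refine ⟨.or (.and (.var a) G') (.and (.neg (.var a)) G), fun v => ?_⟩
    cases h : v a <;> simp [PropFormula.eval, Finset.filter_insert, h, hG, hG']

/-- A formula for `leastAbduct S` is obtained by prescribing its models, one for each set of
hypotheses that is to be consistent. -/
theorem exists_abduct_eq_leastAbduct {I C : Finset Var} (hd : Disjoint I C) {S : Set Explanation}
    (hS : ∀ x ∈ S, x.1 ⊆ I ∧ x.2 ⊆ C) :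
    ∃ G : PropFormula, (AbductionFrame.mk G I C hd).abduct = leastAbduct S := by
  let cl (X : Finset Var) (m : Var) : Prop := ∃ E ⊆ X, ∃ M, m ∈ M ∧ (E, M) ∈ S
  obtain ⟨G, hG⟩ := exists_formula (I ∪ C) fun T =>
    (∃ E, T ∩ I ⊆ E ∧ ∃ M, (E, M) ∈ S) ∧ ∀ m ∈ C, m ∈ T ↔ cl (T ∩ I) m
  -- The models of `G` with hypotheses `X` make exactly the manifestations `m` with `cl X m` true.
  have hG' (v : Var → Bool) : G.eval v = true ↔ (∃ E, I.filter (v · = true) ⊆ E ∧ ∃ M, (E, M) ∈ S) ∧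
      ∀ m ∈ C, v m = true ↔ cl (I.filter (v · = true)) m := by
    have e : (I ∪ C).filter (v · = true) ∩ I = I.filter (v · = true) := by
      ext x; simp only [Finset.mem_inter, Finset.mem_filter, Finset.mem_union]; tauto
    rw [hG, e]
    refine and_congr_right fun _ => forall₂_congr fun m hm => ?_
    simp [hm]
  -- Every `X ⊆ I` below an explaining set is the set of hypotheses of a model.
  have model (X : Finset Var) (hX : X ⊆ I) (h : ∃ E, X ⊆ E ∧ ∃ M, (E, M) ∈ S) :
      ∃ v, IsModel v G X ∧ ∀ m ∈ C, v m = true ↔ cl X m := by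
    classical
    let v : Var → Bool := fun x => decide (x ∈ X ∨ x ∈ C ∧ cl X x)
    have hv : I.filter (v · = true) = X := by
      ext x
      simp only [v, Finset.mem_filter, decide_eq_true_eq]
      have : x ∈ I → x ∉ C := fun h => Finset.disjoint_left.1 hd h
      have : x ∈ X → x ∈ I := fun h => hX h
      tauto
    have hC : ∀ m ∈ C, v m = true ↔ cl X m := by
      intro m hm
      have : m ∉ X := fun h => Finset.disjoint_left.1 hd (hX h) hm
      simp [v, hm, this]
    exact ⟨v, ⟨(hG' v).2 (by rw [hv]; exact ⟨h, hC⟩), fun e he => by simp [v, he]⟩, hC⟩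
  refine ⟨G, Set.ext fun ⟨E, M⟩ => ?_⟩
  rw [mem_abduct]
  constructor
  · rintro ⟨⟨hE, hM, hne⟩, ⟨v, hv, hv'⟩, he⟩
    obtain ⟨⟨E₀, h₁, h₂⟩, -⟩ := (hG' v).1 hv
    have hEE : E ⊆ E₀ := fun x hx => h₁ (Finset.mem_filter.2 ⟨hE hx, hv' x hx⟩)
    obtain ⟨w, hw, hc⟩ := model E hE ⟨E₀, hEE, h₂⟩
    exact ⟨hne, ⟨E₀, hEE, h₂⟩, fun m hm => (hc m (hM hm)).1 (he w hw m hm)⟩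
  · rintro ⟨hne, hE, hM⟩
    have hEI : E ⊆ I := by
      obtain ⟨E₀, h₁, M₀, h₂⟩ := hE
      exact h₁.trans (hS _ h₂).1
    have hMC : M ⊆ C := by
      intro m hm
      obtain ⟨E₁, -, M₁, h₁, h₂⟩ := hM m hm
      exact (hS _ h₂).2 h₁
    refine ⟨⟨hEI, hMC, hne⟩, (model E hEI hE).imp fun v h => h.1, fun v hv m hm => ?_⟩
    obtain ⟨E₁, h₁, h₂⟩ := hM m hm
    exact (((hG' v).1 hv.1).2 m (hMC hm)).2 ⟨E₁, fun x hx =>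
      Finset.mem_filter.2 ⟨hEI (h₁ hx), hv.2 x (h₁ hx)⟩, h₂⟩

theorem leastAbduct_subset {A : AbductionFrame} {S : Set Explanation} (h : S ⊆ A.abduct) :
    leastAbduct S ⊆ A.abduct := by
  rintro ⟨E, M⟩ ⟨hne, ⟨E₀, h₀, M₀, h₁⟩, hM⟩
  refine ⟨h₀.trans (h h₁).1, fun m hm => ?_, hne, ?_, fun v hv m hm => ?_⟩
  · obtain ⟨E₁, -, M₁, h₂, h₃⟩ := hM m hm
    exact (h h₃).2.1 h₂
  · obtain ⟨v, hv, hv'⟩ := (h h₁).2.2.2.1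
    exact ⟨v, hv, fun e he => hv' e (h₀ he)⟩
  · obtain ⟨E₁, h₂, M₁, h₃, h₄⟩ := hM m hm
    exact (h h₄).2.2.2.2 v ⟨hv.1, fun e he => hv.2 e (h₂ he)⟩ m h₃

theorem subset_leastAbduct {S : Set Explanation} (hS : ∀ x ∈ S, x.2.Nonempty) :
    S ⊆ leastAbduct S :=
  fun x hx => ⟨hS x hx, ⟨x.1, subset_rfl, x.2, hx⟩, fun _ hm => ⟨x.1, subset_rfl, x.2, hm, hx⟩⟩

/-- As the hypotheses have only finitely many subsets, every explanation that is not minimal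
is beaten by a minimal one. -/
theorem exists_mem_minabduct {lt : Finset Var → Finset Var → Prop} (lt_irrefl : ∀ E, ¬ lt E E)
    (lt_trans : ∀ E₁ E₂ E₃, lt E₁ E₂ → lt E₂ E₃ → lt E₁ E₃)
    {A : AbductionFrame} {E M : Finset Var} (h : (E, M) ∈ A.abduct) :
    ∃ E', (E' = E ∨ lt E' E) ∧ (E', M) ∈ A.minabduct lt := by
  have : IsStrictOrder (Finset Var) lt := { irrefl := lt_irrefl, trans := lt_trans }
  have wf := (A.hyps.powerset.finite_toSet).wellFoundedOn (r := lt)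
  obtain ⟨⟨E', hE'⟩, ⟨h₁, h₂⟩, hmin⟩ := WellFounded.has_min wf
    {E' | (E' = E ∨ lt E' E) ∧ (E'.1, M) ∈ A.abduct}
    ⟨⟨E, by simpa using h.1⟩, .inl rfl, h⟩
  refine ⟨E', h₁, h₂, fun ⟨E'', h₃, h₄⟩ => hmin ⟨E'', by simpa using h₃.1⟩ ⟨.inr ?_, h₃⟩ h₄⟩
  exact h₁.elim (fun e => e ▸ h₄) fun h => lt_trans _ _ _ h₄ h

/-- The set `S` is the set of the minimal explanations of a formula if and only if it is that of the
minimal explanations of `leastAbduct S`. -/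
theorem exists_minabduct_eq_iff {lt : Finset Var → Finset Var → Prop} (lt_irrefl : ∀ E, ¬ lt E E)
    (lt_trans : ∀ E₁ E₂ E₃, lt E₁ E₂ → lt E₂ E₃ → lt E₁ E₃)
    {I C : Finset Var} (hd : Disjoint I C) {S : Set Explanation}
    (hS : ∀ x ∈ S, x.1 ⊆ I ∧ x.2 ⊆ C) (hS' : ∀ x ∈ S, x.2.Nonempty) :
    (∃ G, (AbductionFrame.mk G I C hd).minabduct lt = S) ↔ Unbeaten lt S ∧ Dominating lt S := by
  constructor
  · rintro ⟨G, rfl⟩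
    set A := AbductionFrame.mk G I C hd
    have hA : leastAbduct (A.minabduct lt) ⊆ A.abduct := leastAbduct_subset fun x hx => hx.1
    exact ⟨fun E M h ⟨E', h₁, h₂⟩ => h.2 ⟨E', hA h₂, h₁⟩,
      fun E M h => exists_mem_minabduct lt_irrefl lt_trans (hA h)⟩
  · rintro ⟨hu, hdom⟩
    obtain ⟨G, hG⟩ := exists_abduct_eq_leastAbduct hd hS
    refine ⟨G, Set.ext fun ⟨E, M⟩ => ?_⟩
    simp only [AbductionFrame.minabduct, hG, Set.mem_ofPred_eq]
    constructor
    · rintro ⟨h₁, h₂⟩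
      obtain ⟨E', rfl | hl, h₃⟩ := hdom E M h₁
      · exact h₃
      · exact absurd ⟨E', subset_leastAbduct hS' h₃, hl⟩ h₂
    · exact fun h => ⟨subset_leastAbduct hS' h, fun ⟨E', h₁, h₂⟩ => hu E M h ⟨E', h₂, h₁⟩⟩

/-! ### The complexity of expressing a set of explanations by a formula -/

section

variable {f g d : Data → Data} {lt : Finset Var → Finset Var → Prop}
  {S : Data → Set Explanation}

/-- The universal quantifier over the explained manifestations ranges over the elements of a list,
and therefore does not lead out of the class. -/
theorem sig_leastAbduct {k : ℕ}
    (hS : ∀ {d f g : Data → Data}, PolyTime d → PolyTime f → PolyTime g →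
      Sig (k + 1) fun x => (vset (f x), vset (g x)) ∈ S (d x))
    (hI : ∀ d, ∀ x ∈ S d, x.1 ⊆ vset d.tl.hd ∧ x.2 ⊆ vset d.tl.tl.hd)
    (hd : PolyTime d) (hf : PolyTime f) (hg : PolyTime g) :
    Sig (k + 1) fun x => (vset (f x), vset (g x)) ∈ leastAbduct (S (d x)) := by
  refine .and (InP.sig (.nonempty hg) _) (.and ?_ ?_)
  · refine .exists_subset (P := fun E x => vset (f x) ⊆ E ∧ ∃ M, (E, M) ∈ S (d x))
      (g := fun x => (d x).tl.hd) (.and (InP.sig (.subset ?_ ?_) _)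
        (.exists_subset (P := fun M z => (vset z.hd, M) ∈ S (d z.tl))
          (g := fun z => (d z.tl).tl.tl.hd) (hS ?_ ?_ ?_) ?_ fun s x h => (hI _ _ h).2))
          ?_ fun s x h => (hI _ _ h.2.choose_spec).1
    all_goals fun_prop
  · refine .forall_vset (P := fun m x => ∃ E ⊆ vset (f x), ∃ M, m ∈ M ∧ (E, M) ∈ S (d x))
      (.exists_subset (P := fun E z => E ⊆ vset (f z.tl) ∧
          ∃ M, decVar z.hd ∈ M ∧ (E, M) ∈ S (d z.tl))
        (g := fun z => (d z.tl).tl.hd) (.and (InP.sig (.subset ?_ ?_) _)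
          (.exists_subset (P := fun M z => decVar z.tl.hd ∈ M ∧ (vset z.hd, M) ∈ S (d z.tl.tl))
            (g := fun z => (d z.tl.tl).tl.tl.hd) (.and (InP.sig (.mem_vset ?_ ?_) _) (hS ?_ ?_ ?_))
            ?_ fun s x h => (hI _ _ h.2).2))
        ?_ fun s x h => (hI _ _ h.2.choose_spec.2).1) hg
    all_goals fun_prop

/-- The condition `Unbeaten` universally quantifies a combination of the complements of two
predicates in `Σ₃ᵖ`, and so is even in `Π₃ᵖ`. In `Dominating` the second predicate is not
complemented, which costs one more quantifier alternation. -/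
theorem pi_unbeaten_and_dominating (hlt : compareProblem lt ∈ ClassP)
    (hS : ∀ {d f g : Data → Data}, PolyTime d → PolyTime f → PolyTime g →
      Sig 3 fun x => (vset (f x), vset (g x)) ∈ S (d x))
    (hI : ∀ d, ∀ x ∈ S d, x.1 ⊆ vset d.tl.hd ∧ x.2 ⊆ vset d.tl.tl.hd) :
    Pi 4 fun d => Unbeaten lt (S d) ∧ Dominating lt (S d) := by
  have hL (d : Data) (x : Explanation) (h : x ∈ leastAbduct (S d)) :
      x.1 ⊆ vset d.tl.hd ∧ x.2 ⊆ vset d.tl.tl.hd := by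
    obtain ⟨-, ⟨E, h₁, M, h₂⟩, h₃⟩ := h
    refine ⟨h₁.trans (hI d _ h₂).1, fun m hm => ?_⟩
    obtain ⟨E, -, M, h₁, h₂⟩ := h₃ m hm
    exact (hI d _ h₂).2 h₁
  refine .and (.succ ?_) ?_
  · have : Sig 3 fun d => ∃ E M, (E, M) ∈ S d ∧ ∃ E', lt E' E ∧ (E', M) ∈ leastAbduct (S d) := by
      refine .exists_subset (P := fun E d => ∃ M, (E, M) ∈ S d ∧
          ∃ E', lt E' E ∧ (E', M) ∈ leastAbduct (S d)) (g := fun d => d.tl.hd)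
        (.exists_subset (P := fun M z => (vset z.hd, M) ∈ S z.tl ∧
            ∃ E', lt E' (vset z.hd) ∧ (E', M) ∈ leastAbduct (S z.tl)) (g := fun z => z.tl.tl.tl.hd)
          (.and (hS ?_ ?_ ?_) (.exists_subset (P := fun E' y => lt E' (vset y.tl.hd) ∧
              (E', vset y.hd) ∈ leastAbduct (S y.tl.tl)) (g := fun y => y.tl.tl.tl.hd)
            (.and (InP.sig (.lt hlt ?_ ?_) _) (sig_leastAbduct hS hI ?_ ?_ ?_)) ?_
            fun s x h => (hL _ _ h.2).1)) ?_ fun s x h => (hI _ _ h.1).2) ?_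
        fun s x h => (hI _ _ h.choose_spec.1).1
      all_goals fun_prop
    exact this.not.congr fun d => by simp [Unbeaten]
  · have : Sig 4 fun d => ∃ E M, (E, M) ∈ leastAbduct (S d) ∧
        ¬ ∃ E', (E' = E ∨ lt E' E) ∧ (E', M) ∈ S d := by
      refine .exists_subset (P := fun E d => ∃ M, (E, M) ∈ leastAbduct (S d) ∧
          ¬ ∃ E', (E' = E ∨ lt E' E) ∧ (E', M) ∈ S d) (g := fun d => d.tl.hd)
        (.exists_subset (P := fun M z => (vset z.hd, M) ∈ leastAbduct (S z.tl) ∧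
            ¬ ∃ E', (E' = vset z.hd ∨ lt E' (vset z.hd)) ∧ (E', M) ∈ S z.tl)
          (g := fun z => z.tl.tl.tl.hd)
          (.and (Sig.succ (sig_leastAbduct hS hI ?_ ?_ ?_))
            (Pi.sig_succ (Sig.not (.exists_subset (P := fun E' y =>
                (E' = vset y.tl.hd ∨ lt E' (vset y.tl.hd)) ∧ (E', vset y.hd) ∈ S y.tl.tl)
              (g := fun y => y.tl.tl.tl.hd)
              (.and (InP.sig (.or ?_ (.lt hlt ?_ ?_)) _) (hS ?_ ?_ ?_)) ?_
              fun s x h => (hI _ _ h.2).1))))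
          ?_ fun s x h => (hL _ _ h.1).2) ?_
        fun s x h => (hL _ _ h.choose_spec.1).1
      any_goals fun_prop
      refine (InP.and (.subset ?_ ?_) (.subset ?_ ?_)).congr fun x =>
        Finset.Subset.antisymm_iff.symm
      all_goals fun_prop
    exact this.not.congr fun d =>
      ⟨fun h E M hx => by_contra fun h' => h ⟨E, M, hx, h'⟩, fun h ⟨E, M, hx, h'⟩ => h' (h E M hx)⟩

/-- The tree is an encoding of an input of the two decision problems. -/
def IsInput (d : Data) : Prop :=
  d = .cons d.hd (.cons d.tl.hd (.cons d.tl.tl.hd d.tl.tl.tl)) ∧ encodeFormula (decF d.hd) = d.hd ∧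
    normList d.tl.hd = d.tl.hd ∧ normList d.tl.tl.hd = d.tl.tl.hd ∧
    normList d.tl.tl.tl = d.tl.tl.tl ∧ Disjoint (vset d.tl.hd) (vset d.tl.tl.hd)

theorem inP_isInput : InP IsInput := by
  refine .and (.eq ?_ ?_) (.and (.isFormula ?_) (.and (.eq (.normList ?_) ?_)
    (.and (.eq (.normList ?_) ?_) (.and (.eq (.normList ?_) ?_) (.disjoint ?_ ?_)))))
  all_goals fun_prop

theorem encodesInput_iff {d : Data} {A : AbductionFrame} {R : Finset Var} :
    EncodesInput d A R ↔ IsInput d ∧ A = frameOf d ∧ R = rememberOf d := by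
  constructor
  · rintro ⟨i, c, r, hi, hc, hr, rfl⟩
    obtain ⟨F, I, C, hd⟩ := A
    obtain ⟨ni, rfl⟩ := encodesSet_iff.1 hi
    obtain ⟨nc, rfl⟩ := encodesSet_iff.1 hc
    obtain ⟨nr, rfl⟩ := encodesSet_iff.1 hr
    simp [IsInput, frameOf, rememberOf, ni, nc, nr, hd, hd.symm.sdiff_eq_left]
  · rintro ⟨⟨e, hF, ni, nc, nr, hd⟩, rfl, rfl⟩
    refine ⟨d.tl.hd, d.tl.tl.hd, d.tl.tl.tl, encodesSet_iff.2 ⟨ni, rfl⟩, encodesSet_iff.2 ⟨nc, ?_⟩,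
      encodesSet_iff.2 ⟨nr, rfl⟩, ?_⟩
    · simp [frameOf, hd.symm.sdiff_eq_left]
    · simpa [frameOf, hF] using e

end

/-- If the result `S A R` of forgetting is a set of explanations whose membership problem is in
`Σ₃ᵖ`, then it is decidable in `Π₄ᵖ` whether a formula expresses it. -/
theorem piP_of_sig {lt : Finset Var → Finset Var → Prop} (lt_irrefl : ∀ E, ¬ lt E E)
    (lt_trans : ∀ E₁ E₂ E₃, lt E₁ E₂ → lt E₂ E₃ → lt E₁ E₃) (hlt : compareProblem lt ∈ ClassP)
    {S : AbductionFrame → Finset Var → Set Explanation}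
    (hS : ∀ {d f g : Data → Data}, PolyTime d → PolyTime f → PolyTime g →
      Sig 3 fun x => (vset (f x), vset (g x)) ∈ S (frameOf (d x)) (rememberOf (d x)))
    (hR : ∀ A R, ∀ x ∈ S A R, (x.1 ⊆ A.hyps ∩ R ∧ x.2 ⊆ A.manis ∩ R) ∧ x.2.Nonempty) :
    {d | ∃ A R, EncodesInput d A R ∧ ∃ G, (A.remember R G).minabduct lt = S A R} ∈ PiP 4 := by
  have key : Pi 4 fun d => IsInput d ∧ Unbeaten lt (S (frameOf d) (rememberOf d)) ∧
      Dominating lt (S (frameOf d) (rememberOf d)) :=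
    .and (inP_isInput.pi 4) (pi_unbeaten_and_dominating
      (S := fun d => S (frameOf d) (rememberOf d)) hlt hS fun d x hx =>
        ⟨(hR _ _ x hx).1.1.trans Finset.inter_subset_left,
          ((hR _ _ x hx).1.2.trans Finset.inter_subset_left).trans (frameOf_manis_subset d)⟩)
  refine key.congr fun d => ?_
  have (A : AbductionFrame) (R : Finset Var) := exists_minabduct_eq_iff lt_irrefl lt_trans
    (A.disj.mono Finset.inter_subset_left Finset.inter_subset_left)
    (fun x hx => (hR A R x hx).1) (fun x hx => (hR A R x hx).2)
  simp only [encodesInput_iff]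
  constructor
  · rintro ⟨h, h'⟩
    exact ⟨_, _, ⟨h, rfl, rfl⟩, (this _ _).2 h'⟩
  · rintro ⟨A, R, ⟨h, rfl, rfl⟩, h'⟩
    exact ⟨h, (this _ _).1 h'⟩

end AbdForget

theorem mainTheorem8 (lt : Finset AbdForget.Var → Finset AbdForget.Var → Prop)
    (lt_irrefl : ∀ E, ¬ lt E E)
    (lt_trans : ∀ E₁ E₂ E₃, lt E₁ E₂ → lt E₂ E₃ → lt E₁ E₃)
    (lt_of_ssubset : ∀ E' E, E' ⊂ E → lt E' E)
    (lt_poly : AbdForget.compareProblem lt ∈ AbdForget.ClassP) :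
    AbdForget.focusProblem lt ∈ AbdForget.PiP 4 ∧
      AbdForget.summarizeProblem lt ∈ AbdForget.PiP 4 := by
  refine ⟨AbdForget.piP_of_sig lt_irrefl lt_trans lt_poly (S := fun A R => A.focus lt R)
    (AbdForget.sig_focus lt_poly) fun A R x hx => ⟨⟨hx.1, hx.2.1⟩, hx.2.2.1⟩,
    AbdForget.piP_of_sig lt_irrefl lt_trans lt_poly (S := fun A R => A.summarize lt R)
    (AbdForget.sig_summarize lt_poly) fun A R x hx => ⟨⟨hx.1, hx.2.1⟩, ?_⟩⟩
  obtain ⟨E', -, h⟩ := hx.2.2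
  exact h.1.2.2.1
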